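/- Let $m>2$ be an integer, let $0<2\alpha<1$, and let $R_m^+=\{x\in\mathbb R^m: x_1>0\}$. For $x,\xi\in R_m^+$, $x\ne\xi$, put $$r^2=\sum_{i=1}^m(x_i-\xi_i)^2,\qquad r_1^2=(x_1+\xi_1)^2+\sum_{i=2}^m(x_i-\xi_i)^2,\qquad k_1=\frac{\Gamma(\alpha)\,\Gamma\!\left(\alpha+\frac{m-2}{2}\right)}{4^{1-\alpha}\pi^{m/2}\,\Gamma(2\alpha)},$$ $$q_1(x,\xi)=k_1\,(r^2)^{-\alpha-\frac{m-2}{2}}\,F\!\left(\alpha+\tfrac{m-2}{2},\alpha;2\alpha;1-\tfrac{r_1^2}{r^2}\right),$$ where $F$ is the Gauss hypergeometric function, continued analytically to $(-\infty,1)$; $q_1$ is a fundamental solution of $\sum_{i=1}^m u_{x_ix_i}+\frac{2\alpha}{x_1}u_{x_1}=0$. Let $\Omega\subset R_m^+$ be a bounded domain, let $\Gamma=\partial\Omega\cap R_m^+$ (so that the rest of $\partial\Omega$ lies in the hyperplane $x_1=0$), and assume that $\Gamma$ is a Lyapunov surface which approaches the hyperplane $x_1=0$ under a right angle. That is: near each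 of its points $\Gamma$ is a regular level set of a $C^1$ function, with $\Omega$ on one side of it; there are constants $a,\kappa>0$ such that the angle between the outer unit normals $n(x)$ and $n(y)$ is at most $a|x-y|^{\kappa}$ for all $x,y\in\Gamma$; and $n_1(x)\to0$ as $x\in\Gamma$ tends to a point of $\overline\Gamma\cap\{x_1=0\}$. Let $\rho_1$ be a continuous function on $\overline\Gamma$, and let $$v^{(1)}(x)=\int_\Gamma\rho_1(\xi)\,q_1(\xi,x)\,d_\xi\Gamma,\qquad K_1(s,t)=t_1^{2\alpha}\,\frac{\partial}{\partial n_t}q_1(s,t)\quad(s,t\in\Gamma,\ s\ne t),$$ where $d\Gamma$ is the surface measure and $\partial/\partial n_t$ is the derivative with respect to $t$ in the direction $n(t)$. Then $v^{(1)}$ is given by an absolutely convergent integral and is differentiable at every point of $R_m^+\setminus\Gamma$. For every $t\in\Gamma$ and all sufficiently small $h>0$ one has $t-h\,n(t)\in\Omega$ and $t+h\,n(t)\in R_m^+\setminus\overline\Omega$, the function $s\mapsto\rho_1(s)K_1(s,t)$ is integrable over $\Gamma$, and the limits of the normal derivative from the inside and from the outside, $$\frac{\partial}{\partial n}\{v^{(1)}(t)\}_i=\lim_{h\to0+}n(t)\cdot\nabla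 v^{(1)}(t-h\,n(t)),\qquad \frac{\partial}{\partial n}\{v^{(1)}(t)\}_e=\lim_{h\to0+}n(t)\cdot\nabla v^{(1)}(t+h\,n(t)),$$ exist and satisfy $$t_1^{2\alpha}\frac{\partial}{\partial n}\{v^{(1)}(t)\}_i=\tfrac12\rho_1(t)+\int_\Gamma\rho_1(s)K_1(s,t)\,d_s\Gamma,$$ $$t_1^{2\alpha}\frac{\partial}{\partial n}\{v^{(1)}(t)\}_e=-\tfrac12\rho_1(t)+\int_\Gamma\rho_1(s)K_1(s,t)\,d_s\Gamma,$$ $$\frac{\partial}{\partial n}\{v^{(1)}(t)\}_i-\frac{\partial}{\partial n}\{v^{(1)}(t)\}_e=t_1^{-2\alpha}\rho_1(t).$$ -/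

import Mathlib

open MeasureTheory Filter Topology

namespace SimpleLayer

/-! ### The Gauss hypergeometric function -/

/-- The Gauss hypergeometric function `F(a, b; c; z)` for real `0 < b < c` and `z < 1`. The
hypergeometric series converges only for `|z| < 1`; its analytic continuation to `z < 1` is given
by Euler's integral, which is taken as the definition. Agreement with the series for `|z| < 1` is
`gaussF_eq_series`. -/
noncomputable def gaussF (a b c z : ℝ) : ℝ :=
  Real.Gamma c / (Real.Gamma b * Real.Gamma (c - b)) *
    ∫ τ in (0 : ℝ)..1, τ ^ (b - 1) * (1 - τ) ^ (c - b - 1) * (1 - z * τ) ^ (-a)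

theorem gamma_add_nat {b : ℝ} (hb : 0 < b) (n : ℕ) :
    Real.Gamma (b + n) = (ascPochhammer ℝ n).eval b * Real.Gamma b := by
  induction n with
  | zero => simp
  | succ n ih =>
    have h : b + n ≠ 0 := by positivity
    rw [Nat.cast_succ, ← add_assoc, Real.Gamma_add_one h, ih, ascPochhammer_succ_right]
    simp
    ring

theorem real_beta {u v : ℝ} (hu : 0 < u) (hv : 0 < v) :
    IntervalIntegrable (fun τ : ℝ => τ ^ (u - 1) * (1 - τ) ^ (v - 1)) volume 0 1 ∧
    ∫ τ in (0 : ℝ)..1, τ ^ (u - 1) * (1 - τ) ^ (v - 1) =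
      Real.Gamma u * Real.Gamma v / Real.Gamma (u + v) := by
  have hc := Complex.betaIntegral_convergent (u := u) (v := v) (by simpa) (by simpa)
  have he : Set.EqOn (fun x : ℝ => (x : ℂ) ^ ((u : ℂ) - 1) * (1 - (x : ℂ)) ^ ((v : ℂ) - 1))
      (fun x : ℝ => ((x ^ (u - 1) * (1 - x) ^ (v - 1) : ℝ) : ℂ)) (Set.uIoc 0 1) := by
    intro x hx
    rw [Set.uIoc_of_le zero_le_one] at hx
    have h1 : 0 ≤ 1 - x := by linarith [hx.2]
    simp only [Complex.ofReal_mul, Complex.ofReal_cpow hx.1.le, Complex.ofReal_cpow h1]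
    push_cast
    rfl
  constructor
  · have h2 := (hc.congr he).norm
    refine h2.congr ?_
    intro x hx
    rw [Set.uIoc_of_le zero_le_one] at hx
    have h1 : 0 ≤ 1 - x := by linarith [hx.2]
    have h3 := Real.rpow_nonneg hx.1.le (u - 1)
    have h4 := Real.rpow_nonneg h1 (v - 1)
    simp only [Complex.norm_real, Real.norm_eq_abs]
    exact abs_of_nonneg (mul_nonneg h3 h4)
  · have h := Complex.betaIntegral_eq_Gamma_mul_div u v (by simpa) (by simpa)
    rw [Complex.betaIntegral, intervalIntegral.integral_congr_ae
      (Filter.Eventually.of_forall fun x hx => he hx), intervalIntegral.integral_ofReal,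
      ← Complex.ofReal_add, Complex.Gamma_ofReal, Complex.Gamma_ofReal, Complex.Gamma_ofReal] at h
    exact_mod_cast h

theorem choose_eq_poch (a : ℝ) (n : ℕ) :
    Ring.choose (a + n - 1) n = (n.factorial : ℝ)⁻¹ * (ascPochhammer ℝ n).eval a := by
  have h := Ring.factorial_nsmul_multichoose_eq_ascPochhammer a n
  rw [Polynomial.ascPochhammer_smeval_eq_eval, nsmul_eq_mul] at h
  rw [Ring.choose, show a + n - 1 - n + 1 = a by ring, ← h]
  have : (n.factorial : ℝ) ≠ 0 := by positivity
  field_simp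

/-- On the disc of convergence `gaussF` is the sum of the Gauss series. -/
theorem gaussF_eq_series (a : ℝ) {b c z : ℝ} (hb : 0 < b) (hbc : b < c) (hz : |z| < 1) :
    gaussF a b c z = ₂F₁ a b c z := by
  set k : ℕ → ℝ := fun n => Ring.choose (a + n - 1) n with hk
  have hps := Real.one_div_one_sub_rpow_hasFPowerSeriesOnBall_zero a
  have hsum : ∀ x : ℝ, |x| < 1 → HasSum (fun n => k n * x ^ n) ((1 - x) ^ (-a)) := by
    intro x hx
    have h1 : x ∈ Metric.eball (0 : ℝ) 1 := by
      simpa [enorm_eq_nnnorm, ← NNReal.coe_lt_coe] using hx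
    have h := hps.hasSum h1
    have h2 : (0:ℝ) ≤ 1 - x := by linarith [(abs_lt.1 hx).2]
    simpa [FormalMultilinearSeries.ofScalars_apply_eq, Real.rpow_neg h2, hk, mul_comm] using h
  have habs : Summable fun n => |k n| * |z| ^ n := by
    have h1 : z ∈ Metric.eball (0 : ℝ) 1 := by
      simpa [enorm_eq_nnnorm, ← NNReal.coe_lt_coe] using hz
    have h := FormalMultilinearSeries.summable_norm_apply _ (Metric.eball_subset_eball hps.r_le h1)
    refine h.congr fun n => ?_
    rw [FormalMultilinearSeries.ofScalars_apply_eq]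
    simp [hk]
  obtain ⟨hwi, -⟩ := real_beta hb (sub_pos.2 hbc)
  have hmain := intervalIntegral.hasSum_integral_of_dominated_convergence (μ := volume)
    (a := 0) (b := 1)
    (F := fun n τ => τ ^ (b - 1) * (1 - τ) ^ (c - b - 1) * (k n * (z * τ) ^ n))
    (f := fun τ => τ ^ (b - 1) * (1 - τ) ^ (c - b - 1) * (1 - z * τ) ^ (-a))
    (fun n τ => τ ^ (b - 1) * (1 - τ) ^ (c - b - 1) * (|k n| * |z| ^ n))
    (fun n => (by fun_prop : Measurable _).aestronglyMeasurable)
    (fun n => Filter.Eventually.of_forall fun τ hτ => ?_)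
    (Filter.Eventually.of_forall fun τ hτ => habs.mul_left _)
    (by simp_rw [tsum_mul_left]; exact hwi.mul_const _)
    (Filter.Eventually.of_forall fun τ hτ => ?_)
  rotate_left
  · rw [Set.uIoc_of_le zero_le_one] at hτ
    have h1 : 0 ≤ 1 - τ := by linarith [hτ.2]
    have h3 := Real.rpow_nonneg hτ.1.le (b - 1)
    have h4 := Real.rpow_nonneg h1 (c - b - 1)
    rw [Real.norm_eq_abs, abs_mul, abs_of_nonneg (mul_nonneg h3 h4), abs_mul, abs_pow, abs_mul,
      abs_of_pos hτ.1]
    have h5 : |z| * τ ≤ |z| := mul_le_of_le_one_right (abs_nonneg z) hτ.2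
    have h6 : 0 ≤ |z| * τ := mul_nonneg (abs_nonneg z) hτ.1.le
    gcongr
  · rw [Set.uIoc_of_le zero_le_one] at hτ
    refine (hsum _ ?_).mul_left _
    rw [abs_mul, abs_of_pos hτ.1]
    exact lt_of_le_of_lt (mul_le_of_le_one_right (abs_nonneg z) hτ.2) hz
  rw [gaussF, ← hmain.tsum_eq, ← tsum_mul_left, ordinaryHypergeometric_eq_tsum]
  refine tsum_congr fun n => ?_
  have hbn : 0 < b + n := by positivity
  have hcn : 0 < c + n := by linarith
  have hI : ∫ τ in (0 : ℝ)..1, τ ^ (b - 1) * (1 - τ) ^ (c - b - 1) * (k n * (z * τ) ^ n) =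
      k n * z ^ n * (Real.Gamma (b + n) * Real.Gamma (c - b) / Real.Gamma (c + n)) := by
    have h := (real_beta hbn (sub_pos.2 hbc)).2
    rw [show b + n + (c - b) = c + n by ring] at h
    rw [← h, ← intervalIntegral.integral_const_mul]
    refine intervalIntegral.integral_congr_ae (Filter.Eventually.of_forall fun τ hτ => ?_)
    rw [Set.uIoc_of_le zero_le_one] at hτ
    rw [show b + n - 1 = b - 1 + n by ring, Real.rpow_add_natCast hτ.1.ne', mul_pow]
    ring
  have hc : 0 < c := hb.trans hbc
  have g1 := (Real.Gamma_pos_of_pos hb).ne'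
  have g2 := (Real.Gamma_pos_of_pos (sub_pos.2 hbc)).ne'
  have g3 := (Real.Gamma_pos_of_pos hc).ne'
  have g4 := (ascPochhammer_pos n c hc).ne'
  rw [hI, gamma_add_nat hb, gamma_add_nat hc, smul_eq_mul]
  simp only [hk, choose_eq_poch]
  field_simp

/-! ### The fundamental solution -/

/-- `r² = ∑ (xᵢ - ξᵢ)²`. -/
noncomputable def rSq {m : ℕ} (x ξ : EuclideanSpace ℝ (Fin m)) : ℝ :=
  ∑ i, (x i - ξ i) ^ 2

/-- `r₁² = (x₁ + ξ₁)² + ∑_{i ≥ 2} (xᵢ - ξᵢ)²`; the coordinate `x₁` has index `0`. -/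
noncomputable def r1Sq {m : ℕ} [NeZero m] (x ξ : EuclideanSpace ℝ (Fin m)) : ℝ :=
  (x 0 + ξ 0) ^ 2 + ∑ i ∈ Finset.univ.erase (0 : Fin m), (x i - ξ i) ^ 2

/-- The constant `k₁`. -/
noncomputable def k1 (m : ℕ) (α : ℝ) : ℝ :=
  Real.Gamma α * Real.Gamma (α + ((m : ℝ) - 2) / 2) /
    ((4 : ℝ) ^ (1 - α) * Real.pi ^ ((m : ℝ) / 2) * Real.Gamma (2 * α))

/-- The fundamental solution `q₁(x, ξ)` of `∑ u_{xᵢxᵢ} + (2α / x₁) u_{x₁} = 0`. -/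
noncomputable def q1 {m : ℕ} [NeZero m] (α : ℝ) (x ξ : EuclideanSpace ℝ (Fin m)) : ℝ :=
  k1 m α * (rSq x ξ) ^ (-α - ((m : ℝ) - 2) / 2) *
    gaussF (α + ((m : ℝ) - 2) / 2) α (2 * α) (1 - r1Sq x ξ / rSq x ξ)

/-! ### Domains bounded by a Lyapunov surface and a part of the hyperplane `x₁ = 0` -/

/-- The open half-space `x₁ > 0`. -/
def halfSpace (m : ℕ) [NeZero m] : Set (EuclideanSpace ℝ (Fin m)) :=
  {x | 0 < x 0}

/-- The part `Γ` of the boundary of `Ω` that lies in `x₁ > 0`. For `Ω ⊆ {x₁ > 0}` the rest of the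
boundary lies in the hyperplane `x₁ = 0`. -/
def surf {m : ℕ} [NeZero m] (Ω : Set (EuclideanSpace ℝ (Fin m))) :
    Set (EuclideanSpace ℝ (Fin m)) :=
  frontier Ω ∩ halfSpace m

/-- `Ω` is a bounded domain in the half-space `x₁ > 0`, and `Γ = surf Ω` is a Lyapunov surface
that approaches the hyperplane `x₁ = 0` under a right angle, with outer unit normal `n`. -/
structure IsLyapunovDomain {m : ℕ} [NeZero m] (Ω : Set (EuclideanSpace ℝ (Fin m)))
    (n : EuclideanSpace ℝ (Fin m) → EuclideanSpace ℝ (Fin m)) : Prop where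
  isOpen : IsOpen Ω
  isConnected : IsConnected Ω
  isBounded : Bornology.IsBounded Ω
  subset_halfSpace : Ω ⊆ halfSpace m
  /-- Near each of its points `Γ` is a regular level set `f = 0` of a `C¹` function, with `Ω` on
  the side `f < 0`, and `n = ∇f / |∇f|` is the outer unit normal. -/
  normal : ∀ p ∈ surf Ω, ∃ U : Set (EuclideanSpace ℝ (Fin m)), IsOpen U ∧ p ∈ U ∧
    ∃ f : EuclideanSpace ℝ (Fin m) → ℝ, ContDiffOn ℝ 1 f U ∧
      (∀ q ∈ U, gradient f q ≠ 0) ∧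
      (∀ q ∈ U, q ∈ Ω ↔ f q < 0) ∧
      ∀ q ∈ surf Ω ∩ U, n q = ‖gradient f q‖⁻¹ • gradient f q
  /-- The angle between the normals at two points is at most `a r ^ κ`. -/
  holder : ∃ a κ : ℝ, 0 < a ∧ 0 < κ ∧ ∀ x ∈ surf Ω, ∀ y ∈ surf Ω,
    InnerProductGeometry.angle (n x) (n y) ≤ a * dist x y ^ κ
  /-- At the edge `Γ̄ ∩ {x₁ = 0}` the normal to `Γ` becomes orthogonal to the `x₁`-axis. -/
  right_angle : ∀ p ∈ closure (surf Ω), p 0 = 0 →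
    Tendsto (fun x => n x 0) (𝓝[surf Ω] p) (𝓝 0)

/-! ### The simple-layer potential -/

/-- The surface measure: Euclidean Hausdorff measure of dimension `m - 1`, restricted to `Γ`. -/
noncomputable def surfMeasure {m : ℕ} [NeZero m] (Ω : Set (EuclideanSpace ℝ (Fin m))) :
    Measure (EuclideanSpace ℝ (Fin m)) :=
  (μHE[m - 1]).restrict (surf Ω)

/-- The simple-layer potential `v⁽¹⁾(x) = ∫_Γ ρ(ξ) q₁(ξ, x) d_ξΓ` with density `ρ`. -/
noncomputable def simpleLayer {m : ℕ} [NeZero m] (α : ℝ) (Ω : Set (EuclideanSpace ℝ (Fin m)))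
    (ρ : EuclideanSpace ℝ (Fin m) → ℝ) (x : EuclideanSpace ℝ (Fin m)) : ℝ :=
  ∫ ξ, ρ ξ * q1 α ξ x ∂(surfMeasure Ω)

/-- The kernel `K₁(s, t) = t₁^{2α} ∂q₁(s, t)/∂n_t`. -/
noncomputable def K1 {m : ℕ} [NeZero m] (α : ℝ)
    (n : EuclideanSpace ℝ (Fin m) → EuclideanSpace ℝ (Fin m))
    (s t : EuclideanSpace ℝ (Fin m)) : ℝ :=
  t 0 ^ (2 * α) * fderiv ℝ (fun x => q1 α s x) t (n t)

end SimpleLayer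

open SimpleLayer

open scoped RealInnerProductSpace

namespace SimpleLayer

variable {m : ℕ} [NeZero m] {Ω : Set (EuclideanSpace ℝ (Fin m))}
  {n : EuclideanSpace ℝ (Fin m) → EuclideanSpace ℝ (Fin m)}

/-! Euler's integral turns `q1` into a constant times `∫ τ^(α-1) (1-τ)^(α-1) (r² + 4 ξ₁ x₁ τ)^(-a)
dτ` with `a = α + (m-2)/2` (`q1_eq_kerW`). Its gradient in `x` has two terms: one along `x - ξ`,
with a coefficient of order `r^(-m)`, and one along the first axis, of order `r^(2-m)`. The exact
form of these singularities comes from a Möbius substitution (`eulerW_eq_eulerJ`), which splits off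
the powers of `r` and `r₁` and leaves a factor `eulerJ` that is continuous up to the value 1 of its
argument, that is, up to `r = 0`.

At `x = t + s n(t)` one has `⟪x - ξ, n(t)⟫ = ⟪t - ξ, n(t)⟫ + s`. The contribution of `⟪t - ξ,
n(t)⟫`, together with the first-axis term, is continuous at `s = 0`: the Hölder condition gives `|⟪t
- ξ, n(t)⟫| ≤ a |ξ - t|^(1+κ)`, so everything is dominated by integrable powers of `|ξ - t|`
(`tendsto_integral_regular_part`). Its value at `s = 0` is the integral of the kernel on `Γ`. The
contribution of `s` behaves like `s (s² + |ξ - t|²)^(-m/2)` times a function with a limit at `t`.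
This is a Poisson kernel on the tangent plane, an approximate identity whose total mass depends only
on the sign of `s` (`tendsto_integral_singular_part`). With the value `k1` the mass amounts to `1/2
· t₁^(-2α)` (`two_mul_qConst_mul`), and the change of sign is the jump.

The surface is handled without charts. A chord of `Γ` cannot cross `Γ` outwards at every meeting
point (`exists_mem_segment_inner_nonpos`). Applied in both directions, this makes chords almost
tangent wherever the normals are close. The projection of a small piece of `Γ` to a tangent plane is
thus injective, with inverse of Lipschitz constant `L` close to 1, so Hausdorff measure on `Γ` is
squeezed between multiples of Lebesgue measure on that plane. Letting `L → 1` gives the exact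
Poisson mass. -/

theorem isOpen_halfSpace : IsOpen (halfSpace m) :=
  isOpen_lt continuous_const (by fun_prop)

theorem convex_halfSpace : Convex ℝ (halfSpace m) := by
  intro x hx y hy a b ha hb hab
  simp only [halfSpace, Set.mem_ofPred_eq, PiLp.add_apply, PiLp.smul_apply, smul_eq_mul] at *
  rcases ha.eq_or_lt with rfl | ha
  · have : b = 1 := by linarith
    simp [this, hy]
  · have := mul_pos ha hx
    have := mul_nonneg hb hy.le
    linarith

theorem measurableSet_surf : MeasurableSet (surf Ω) :=
  isClosed_frontier.measurableSet.inter isOpen_halfSpace.measurableSet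

/-! ### Geometry of `Γ`: sides, chords and the projection along a normal -/

namespace IsLyapunovDomain

theorem notMem_of_mem_surf (hΩ : IsLyapunovDomain Ω n)
    {p : EuclideanSpace ℝ (Fin m)} (hp : p ∈ surf Ω) : p ∉ Ω := by
  have := hp.1
  rw [hΩ.isOpen.frontier_eq] at this
  exact this.2

theorem isBounded_surf (hΩ : IsLyapunovDomain Ω n) : Bornology.IsBounded (surf Ω) :=
  hΩ.isBounded.closure.subset fun _ hx => frontier_subset_closure hx.1

theorem norm_normal (hΩ : IsLyapunovDomain Ω n)
    {p : EuclideanSpace ℝ (Fin m)} (hp : p ∈ surf Ω) : ‖n p‖ = 1 := by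
  obtain ⟨U, -, hpU, f, -, hg, -, hn⟩ := hΩ.normal p hp
  rw [hn p ⟨hp, hpU⟩, norm_smul, norm_inv, norm_norm,
    inv_mul_cancel₀ (norm_ne_zero_iff.2 (hg p hpU))]

/-- A ray that makes an acute angle with the outer normal leaves the closure of the domain, and the
opposite ray enters the domain. -/
theorem eventually_sides (hΩ : IsLyapunovDomain Ω n)
    {p v : EuclideanSpace ℝ (Fin m)} (hp : p ∈ surf Ω) (hv : 0 < ⟪n p, v⟫) :
    (∀ᶠ h : ℝ in 𝓝[>] 0, p - h • v ∈ Ω) ∧ ∀ᶠ h : ℝ in 𝓝[>] 0, p + h • v ∉ closure Ω := by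
  obtain ⟨U, hU, hpU, f, hf, hg, hside, hn⟩ := hΩ.normal p hp
  have hcont : ∀ q ∈ U, ContinuousAt f q := fun q hq =>
    hf.continuousOn.continuousAt (hU.mem_nhds hq)
  have hcl : ∀ q ∈ U, q ∈ closure Ω → f q ≤ 0 := by
    intro q hq hqc
    by_contra! h
    have h1 : ∀ᶠ z in 𝓝 q, 0 < f z ∧ z ∈ U :=
      ((hcont q hq).eventually (lt_mem_nhds h)).and (hU.mem_nhds hq)
    obtain ⟨z, hz, hz1, hz2⟩ := ((mem_closure_iff_frequently.1 hqc).and_eventually h1).exists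
    linarith [(hside z hz2).1 hz]
  have hfp : f p = 0 := by
    refine le_antisymm (hcl p hpU (frontier_subset_closure hp.1)) ?_
    by_contra! h
    exact hΩ.notMem_of_mem_surf hp ((hside p hpU).2 h)
  have hd : HasDerivAt (fun h : ℝ => f (p + h • v)) ⟪gradient f p, v⟫ 0 := by
    have h1 : HasFDerivAt f (fderiv ℝ f p) p :=
      ((hf.contDiffAt (hU.mem_nhds hpU)).differentiableAt one_ne_zero).hasFDerivAt
    have h2 : HasDerivAt (fun h : ℝ => p + h • v) v 0 := by
      simpa using ((hasDerivAt_id (0 : ℝ)).smul_const v).const_add p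
    have h3 := HasFDerivAt.comp_hasDerivAt_of_eq (0 : ℝ) h1 h2 (by simp)
    rw [gradient, InnerProductSpace.toDual_symm_apply]
    exact h3
  have hpos : 0 < ⟪gradient f p, v⟫ := by
    rw [hn p ⟨hp, hpU⟩, real_inner_smul_left] at hv
    exact pos_of_mul_pos_right hv (by positivity)
  have hinU : ∀ᶠ h : ℝ in 𝓝 0, p + h • v ∈ U := by
    have : Tendsto (fun h : ℝ => p + h • v) (𝓝 0) (𝓝 (p + (0 : ℝ) • v)) :=
      (by fun_prop : Continuous fun h : ℝ => p + h • v).tendsto 0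
    rw [zero_smul, add_zero] at this
    exact this.eventually (hU.mem_nhds hpU)
  have hslope := hasDerivAt_iff_tendsto_slope.1 hd
  -- The difference quotient tends to a positive number, so `f (p + h • v)` has the sign of `h` for
  -- small `h`. Reading this at `-h` and at `h` gives the two claims.
  have hsl : ∀ᶠ h : ℝ in 𝓝[≠] 0, 0 < h⁻¹ * f (p + h • v) := by
    have := hslope.eventually (lt_mem_nhds hpos)
    filter_upwards [this] with h hh
    simpa [slope, hfp] using hh
  constructor
  · have hneg : Tendsto (fun h : ℝ => -h) (𝓝[>] 0) (𝓝[≠] 0) := by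
      refine tendsto_nhdsWithin_iff.2 ⟨?_, ?_⟩
      · have : Tendsto (fun h : ℝ => -h) (𝓝 0) (𝓝 (-0)) := continuous_neg.tendsto 0
        rw [neg_zero] at this
        exact this.mono_left nhdsWithin_le_nhds
      · filter_upwards [self_mem_nhdsWithin] with h hh
        simpa using (ne_of_gt hh)
    filter_upwards [hneg.eventually hsl, hneg.eventually (hinU.filter_mono nhdsWithin_le_nhds),
      self_mem_nhdsWithin] with h h1 h2 h3
    rw [Set.mem_Ioi] at h3
    rw [neg_smul, ← sub_eq_add_neg] at h1 h2
    refine (hside _ h2).2 ?_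
    by_contra! h4
    have : (-h)⁻¹ < 0 := inv_lt_zero.2 (by linarith)
    nlinarith
  · filter_upwards [hsl.filter_mono (nhdsWithin_mono 0 fun x (hx : 0 < x) => hx.ne'),
      hinU.filter_mono nhdsWithin_le_nhds, self_mem_nhdsWithin] with h h1 h2 h3 h4
    have h5 := hcl _ h2 h4
    have : 0 < h⁻¹ := inv_pos.2 h3
    nlinarith

/-- A chord of `Γ` from `x` to `y` meets `Γ` at a point where it does not leave the domain. -/
theorem exists_mem_segment_inner_nonpos (hΩ : IsLyapunovDomain Ω n)
    {x y : EuclideanSpace ℝ (Fin m)} (hx : x ∈ surf Ω)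
    (hy : y ∈ surf Ω) : ∃ z ∈ surf Ω ∩ segment ℝ x y, ⟪n z, y - x⟫ ≤ 0 := by
  by_contra! H
  set γ : ℝ → EuclideanSpace ℝ (Fin m) := fun s => x + s • (y - x) with hγ
  have hγc : Continuous γ := by fun_prop
  have hseg : ∀ s ∈ Set.Icc (0 : ℝ) 1, γ s ∈ segment ℝ x y := by
    intro s hs
    rw [segment_eq_image']
    exact ⟨s, hs, rfl⟩
  have hhalf : ∀ s ∈ Set.Icc (0 : ℝ) 1, γ s ∈ halfSpace m := fun s hs =>
    convex_halfSpace.segment_subset hx.2 hy.2 (hseg s hs)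
  have h0 : γ 0 = x := by simp [hγ]
  have h1 : γ 1 = y := by simp [hγ]
  -- Consider the first entrance into `Ω`. If every meeting point is crossed outwards, each meeting
  -- parameter `s > 0` is preceded by parameters in `S`; in particular `S` is nonempty, because of
  -- the endpoint `y`. The point at `inf S` lies on `Γ`, so a positive infimum would be preceded by
  -- elements of `S`, while `inf S = 0` is impossible since the chord leaves the closure of `Ω` at
  -- `x`.
  set S : Set ℝ := {s | s ∈ Set.Icc (0 : ℝ) 1 ∧ γ s ∈ Ω} with hS
  have hback : ∀ s ∈ Set.Icc (0 : ℝ) 1, γ s ∈ surf Ω → 0 < s → ∃ s' ∈ S, s' < s := by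
    intro s hs hγs hpos
    obtain ⟨h, ⟨hh1, hh2⟩, hh3⟩ := (((hΩ.eventually_sides hγs (H _ ⟨hγs, hseg s hs⟩)).1.and
      (Ioo_mem_nhdsGT hpos)).and self_mem_nhdsWithin).exists
    refine ⟨s - h, ⟨⟨by linarith [hh2.2], by linarith [hs.2, hh2.1]⟩, ?_⟩, by linarith [hh2.1]⟩
    rw [show γ (s - h) = γ s - h • (y - x) by simp only [hγ, sub_smul]; abel]
    exact hh1
  have hSne : S.Nonempty := by
    obtain ⟨s, hs, -⟩ := hback 1 (by simp) (h1 ▸ hy) one_pos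
    exact ⟨s, hs⟩
  have hSbdd : BddBelow S := ⟨0, fun s hs => hs.1.1⟩
  set s₀ := sInf S with hs₀
  have hs₀cl : s₀ ∈ closure S := csInf_mem_closure hSne hSbdd
  have hs₀I : s₀ ∈ Set.Icc (0 : ℝ) 1 :=
    closure_minimal (fun s hs => hs.1) isClosed_Icc hs₀cl
  have hγcl : γ s₀ ∈ closure Ω :=
    map_mem_closure hγc hs₀cl fun s hs => hs.2
  have hxΩ := hΩ.notMem_of_mem_surf hx
  have hnot : γ s₀ ∉ Ω := by
    intro hmem
    have hpos : 0 < s₀ := by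
      rcases hs₀I.1.eq_or_lt with h | h
      · rw [← h, h0] at hmem
        exact absurd hmem hxΩ
      · exact h
    have hev : ∀ᶠ s in 𝓝[<] s₀, γ s ∈ Ω :=
      (hγc.continuousAt.eventually (hΩ.isOpen.mem_nhds hmem)).filter_mono nhdsWithin_le_nhds
    obtain ⟨s, hsΩ, hs⟩ := (hev.and (Ioo_mem_nhdsLT hpos)).exists
    have : s₀ ≤ s := csInf_le hSbdd ⟨⟨hs.1.le, hs.2.le.trans hs₀I.2⟩, hsΩ⟩
    linarith [hs.2]
  have hsurf : γ s₀ ∈ surf Ω := ⟨by rw [hΩ.isOpen.frontier_eq]; exact ⟨hγcl, hnot⟩, hhalf _ hs₀I⟩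
  rcases hs₀I.1.eq_or_lt with h | h
  · have hev := (hΩ.eventually_sides hsurf (H _ ⟨hsurf, hseg _ hs₀I⟩)).2
    obtain ⟨ε, hε, hεs⟩ := (mem_nhdsGT_iff_exists_Ioo_subset).1 hev
    obtain ⟨s, hsS, hs⟩ := exists_lt_of_csInf_lt hSne (show sInf S < ε by
      rw [← hs₀, ← h]; exact hε)
    have hs0 : 0 < s := by
      rcases hsS.1.1.eq_or_lt with h' | h'
      · have := hsS.2
        rw [← h', h0] at this
        exact absurd this hxΩ
      · exact h'
    have := hεs ⟨hs0, hs⟩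
    rw [Set.mem_ofPred_eq, ← h, h0] at this
    exact this (subset_closure hsS.2)
  · obtain ⟨s, hs, hlt⟩ := hback s₀ hs₀I hsurf h
    linarith [csInf_le hSbdd hs]

/-- The chord and its reverse give normals `n z` and `n w` whose inner products with `y - x` have
opposite weak signs. Since `n p` is within `D` of both, its inner product with `y - x` is small in
both directions. -/
theorem abs_inner_le_of_normal_close (hΩ : IsLyapunovDomain Ω n)
    {x y p : EuclideanSpace ℝ (Fin m)} (hx : x ∈ surf Ω)
    (hy : y ∈ surf Ω) {D : ℝ} (hD : ∀ z ∈ surf Ω ∩ segment ℝ x y, ‖n z - n p‖ ≤ D) :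
    |⟪n p, y - x⟫| ≤ D * ‖y - x‖ := by
  obtain ⟨z, hz, hzi⟩ := hΩ.exists_mem_segment_inner_nonpos hx hy
  obtain ⟨w, hw, hwi⟩ := hΩ.exists_mem_segment_inner_nonpos hy hx
  rw [segment_symm] at hw
  have key : ∀ z ∈ surf Ω ∩ segment ℝ x y, |⟪n z, y - x⟫ - ⟪n p, y - x⟫| ≤ D * ‖y - x‖ := by
    intro z hz
    rw [← inner_sub_left]
    exact (abs_real_inner_le_norm _ _).trans
      (mul_le_mul_of_nonneg_right (hD z hz) (norm_nonneg _))
  have h1 := abs_le.1 (key z hz)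
  have h2 := abs_le.1 (key w hw)
  rw [← neg_sub y x, inner_neg_right] at hwi
  exact abs_le.2 ⟨by linarith, by linarith⟩

/-- For unit vectors at angle `θ`, `‖n x - n y‖² = 2 - 2 cos θ ≤ θ²`. Lowering the exponent to at
most 1 costs nothing at distances below 1; beyond that the trivial bound 2 suffices, hence the
constant `a + 2`. -/
theorem exists_holder_normal (hΩ : IsLyapunovDomain Ω n)
    : ∃ a κ : ℝ, 0 < a ∧ 0 < κ ∧ κ ≤ 1 ∧ ∀ x ∈ surf Ω, ∀ y ∈ surf Ω,
    ‖n x - n y‖ ≤ a * dist x y ^ κ := by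
  obtain ⟨a, κ, ha, hκ, h⟩ := hΩ.holder
  have hangle : ∀ x ∈ surf Ω, ∀ y ∈ surf Ω, ‖n x - n y‖ ≤ a * dist x y ^ κ := by
    refine fun x hx y hy => le_trans ?_ (h x hx y hy)
    have hnn := InnerProductGeometry.angle_nonneg (n x) (n y)
    have hc := InnerProductGeometry.cos_angle_mul_norm_mul_norm (n x) (n y)
    rw [hΩ.norm_normal hx, hΩ.norm_normal hy] at hc
    have h1 := norm_sub_sq_real (n x) (n y)
    rw [hΩ.norm_normal hx, hΩ.norm_normal hy] at h1
    have h2 := Real.one_sub_sq_div_two_le_cos (x := InnerProductGeometry.angle (n x) (n y))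
    refine abs_le_of_sq_le_sq' ?_ hnn |>.2
    nlinarith
  refine ⟨a + 2, min κ 1, by linarith, lt_min hκ one_pos, min_le_right _ _, fun x hx y hy => ?_⟩
  rcases le_total (dist x y) 1 with hd | hd
  · refine (hangle x hx y hy).trans ?_
    gcongr ?_ * ?_
    · linarith
    · rcases (dist_nonneg (x := x) (y := y)).eq_or_lt with h0 | h0
      · rw [← h0, Real.zero_rpow hκ.ne', Real.zero_rpow (lt_min hκ one_pos).ne']
      · exact Real.rpow_le_rpow_of_exponent_ge h0 hd (min_le_left _ _)
  · have h1 := norm_sub_le (n x) (n y)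
    rw [hΩ.norm_normal hx, hΩ.norm_normal hy] at h1
    have h2 := Real.one_le_rpow hd (lt_min hκ one_pos).le
    nlinarith

/-- Near `t`, the projection of `Γ` along the normal at `t` covers a disc. -/
theorem exists_disc_subset_projection (hΩ : IsLyapunovDomain Ω n)
    {t : EuclideanSpace ℝ (Fin m)} (ht : t ∈ surf Ω) {δ : ℝ}
    (hδ : 0 < δ) : ∃ δ' > 0, ∀ y : EuclideanSpace ℝ (Fin m), ‖y‖ < δ' →
      ∃ s : ℝ, t + y + s • n t ∈ surf Ω ∩ Metric.ball t δ := by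
  obtain ⟨δ₁, hδ₁, hball⟩ := Metric.isOpen_iff.1 (isOpen_halfSpace (m := m)) t ht.2
  set ε := min δ δ₁ with hε
  have hεpos : 0 < ε := lt_min hδ hδ₁
  have hnt := hΩ.norm_normal ht
  have hsides := hΩ.eventually_sides (v := n t) ht (by rw [real_inner_self_eq_norm_sq, hnt]; simp)
  obtain ⟨η, ⟨hη1, hη2⟩, hη⟩ := ((hsides.1.and hsides.2).and
    (Ioo_mem_nhdsGT (half_pos hεpos))).exists
  have hA : ∀ᶠ y : EuclideanSpace ℝ (Fin m) in 𝓝 0, t + y + (-η) • n t ∈ Ω := by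
    have hc : Continuous fun y : EuclideanSpace ℝ (Fin m) => t + y + (-η) • n t := by fun_prop
    refine hc.continuousAt.eventually (hΩ.isOpen.mem_nhds ?_)
    simpa [sub_eq_add_neg] using hη1
  have hB : ∀ᶠ y : EuclideanSpace ℝ (Fin m) in 𝓝 0, t + y + η • n t ∉ closure Ω := by
    have hc : Continuous fun y : EuclideanSpace ℝ (Fin m) => t + y + η • n t := by fun_prop
    refine hc.continuousAt.eventually (isClosed_closure.isOpen_compl.mem_nhds ?_)
    simpa using hη2
  obtain ⟨r, hr, hrs⟩ := Metric.eventually_nhds_iff_ball.1 (hA.and hB)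
  refine ⟨min r (ε / 2), lt_min hr (half_pos hεpos), fun y hy => ?_⟩
  obtain ⟨h1, h2⟩ := hrs y (by simpa using hy.trans_le (min_le_left _ _))
  -- The segment in the direction `n t` starts in `Ω` and ends outside its closure, so by
  -- connectedness it meets the frontier. The radius `δ₁` keeps the meeting point in the half-space,
  -- hence on `Γ`.
  have hpc : IsPreconnected ((fun s : ℝ => t + y + s • n t) '' Set.Icc (-η) η) :=
    isPreconnected_Icc.image _ (by fun_prop)
  have hη0 : -η ≤ η := by linarith [hη.1]
  obtain ⟨_, ⟨s, hs, rfl⟩, hz⟩ :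
      ((fun s : ℝ => t + y + s • n t) '' Set.Icc (-η) η ∩ frontier Ω).Nonempty := by
    by_contra hne
    obtain ⟨z, -, hz1, hz2⟩ := hpc Ω (closure Ω)ᶜ hΩ.isOpen isClosed_closure.isOpen_compl
      (fun z hz => by
        by_contra hz'
        rw [Set.mem_union, not_or, Set.mem_compl_iff, not_not] at hz'
        exact hne ⟨z, hz, by rw [hΩ.isOpen.frontier_eq]; exact ⟨hz'.2, hz'.1⟩⟩)
      ⟨_, ⟨-η, Set.left_mem_Icc.2 hη0, rfl⟩, h1⟩ ⟨_, ⟨η, Set.right_mem_Icc.2 hη0, rfl⟩, h2⟩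
    exact hz2 (subset_closure hz1)
  have hlt : dist (t + y + s • n t) t < ε := by
    rw [dist_eq_norm, show t + y + s • n t - t = y + s • n t by abel]
    refine (norm_add_le _ _).trans_lt ?_
    rw [norm_smul, hnt, mul_one, Real.norm_eq_abs]
    have := abs_le.2 hs
    have := hy.trans_le (min_le_right _ _)
    linarith [hη.2]
  exact ⟨s, ⟨hz, hball (hlt.trans_le (min_le_right _ _))⟩, hlt.trans_le (min_le_left _ _)⟩

end IsLyapunovDomain

end SimpleLayer

/-! ### The Poisson kernel on a Euclidean space -/

section PoissonKernel

/-- The exponent `q = dim V + 1` is the one for which the kernel at height `h` is a mass-preserving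
dilation of the kernel at height 1. -/
theorem scaled_one_add_norm_sq_rpow {V : Type*} [NormedAddCommGroup V]
    [InnerProductSpace ℝ V] {q : ℝ} (hq : q = (Module.finrank ℝ V : ℝ) + 1) {h : ℝ}
    (hh : 0 < h) (v : V) : h * (h ^ 2 + ‖v‖ ^ 2) ^ (-q / 2) =
      (h ^ Module.finrank ℝ V)⁻¹ * (1 + ‖h⁻¹ • v‖ ^ 2) ^ (-q / 2) := by
  have h1 : h ^ 2 + ‖v‖ ^ 2 = h ^ 2 * (1 + ‖h⁻¹ • v‖ ^ 2) := by
    rw [norm_smul, norm_inv, Real.norm_of_nonneg hh.le]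
    field_simp
  rw [h1, Real.mul_rpow (by positivity) (by positivity), ← mul_assoc]
  congr 1
  rw [← Real.rpow_natCast h 2, ← Real.rpow_mul hh.le, ← Real.rpow_natCast h,
    ← Real.rpow_neg hh.le]
  nth_rewrite 1 [← Real.rpow_one h]
  rw [← Real.rpow_add hh]
  congr 1
  rw [hq]
  push_cast
  ring

variable {V : Type*} [NormedAddCommGroup V] [InnerProductSpace ℝ V] [FiniteDimensional ℝ V]
  [MeasurableSpace V] [BorelSpace V]

theorem integrable_one_add_norm_sq_rpow {q : ℝ} (hq : q = (Module.finrank ℝ V : ℝ) + 1) :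
    Integrable (fun v : V => (1 + ‖v‖ ^ 2) ^ (-q / 2)) :=
  integrable_rpow_neg_one_add_norm_sq (by linarith)

/-- Write the power times `Γ(q/2)` as a Gamma integral over `s` and exchange the integrals. The
Gaussian integral over `V` contributes `π^((q-1)/2)` and the remaining integral over `s` is `Γ(1/2)
= √π`. -/
theorem integral_one_add_norm_sq_rpow {q : ℝ} (hq : q = (Module.finrank ℝ V : ℝ) + 1) :
    ∫ v : V, (1 + ‖v‖ ^ 2) ^ (-q / 2) = Real.pi ^ (q / 2) / Real.Gamma (q / 2) := by
  have hqpos : 0 < q / 2 := by rw [hq]; positivity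
  set f : V → ℝ → ℝ := fun v s => s ^ (q / 2 - 1) * Real.exp (-((1 + ‖v‖ ^ 2) * s)) with hf
  have hfnn : ∀ v, ∀ s ∈ Set.Ioi (0 : ℝ), 0 ≤ f v s := fun v s hs =>
    mul_nonneg (Real.rpow_nonneg (le_of_lt hs) _) (Real.exp_nonneg _)
  have hinner : ∀ v, ∫ s in Set.Ioi (0 : ℝ), f v s =
      (1 + ‖v‖ ^ 2) ^ (-q / 2) * Real.Gamma (q / 2) := by
    intro v
    rw [Real.integral_rpow_mul_exp_neg_mul_Ioi hqpos (by positivity), one_div,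
      Real.inv_rpow (by positivity), ← Real.rpow_neg (by positivity), neg_div]
  have hfm : Measurable (Function.uncurry f) := by
    simp only [hf, Function.uncurry_def]
    fun_prop
  have hG := Real.Gamma_pos_of_pos hqpos
  have hInt : Integrable (Function.uncurry f) (volume.prod (volume.restrict (Set.Ioi 0))) := by
    rw [integrable_prod_iff hfm.aestronglyMeasurable]
    constructor
    · refine Eventually.of_forall fun v => ?_
      -- A nonintegrable function has integral 0 by convention, so the nonzero value in `hinner`
      -- proves integrability.
      refine Integrable.of_integral_ne_zero ?_
      simp only [Function.uncurry_apply_pair]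
      rw [hinner]
      positivity
    · have : (fun v => ∫ s in Set.Ioi (0 : ℝ), ‖Function.uncurry f (v, s)‖) =
          fun v => (1 + ‖v‖ ^ 2) ^ (-q / 2) * Real.Gamma (q / 2) := by
        funext v
        rw [← hinner]
        refine setIntegral_congr_fun measurableSet_Ioi fun s hs => ?_
        exact Real.norm_of_nonneg (hfnn v s hs)
      rw [this]
      exact (integrable_one_add_norm_sq_rpow hq).mul_const _
  have hswap := integral_integral_swap hInt
  simp_rw [hinner] at hswap
  rw [integral_mul_const] at hswap
  have hlast : ∫ s in Set.Ioi (0 : ℝ), ∫ v, f v s = Real.pi ^ (q / 2) := by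
    have h1 : ∀ s ∈ Set.Ioi (0 : ℝ), ∫ v, f v s =
        Real.pi ^ ((q - 1) / 2) * (s ^ ((1 / 2 : ℝ) - 1) * Real.exp (-(1 * s))) := by
      intro s hs
      have hs' : 0 < s := hs
      have h2 : ∀ v : V, f v s =
          s ^ (q / 2 - 1) * Real.exp (-(1 * s)) * Real.exp (-s * ‖v‖ ^ 2) := by
        intro v
        simp only [hf]
        rw [mul_assoc, ← Real.exp_add]
        congr 2
        ring
      simp_rw [h2]
      rw [integral_const_mul, GaussianFourier.integral_rexp_neg_mul_sq_norm hs',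
        Real.div_rpow Real.pi_pos.le hs'.le, show (Module.finrank ℝ V : ℝ) / 2 = (q - 1) / 2 by
          rw [hq]; ring]
      have h3 : s ^ ((1 / 2 : ℝ) - 1) = s ^ (q / 2 - 1) / s ^ ((q - 1) / 2) := by
        rw [← Real.rpow_sub hs']
        congr 1
        ring
      rw [h3]
      ring
    rw [setIntegral_congr_fun measurableSet_Ioi h1, integral_const_mul,
      Real.integral_rpow_mul_exp_neg_mul_Ioi (by norm_num) one_pos, Real.Gamma_one_half_eq,
      div_one, Real.one_rpow, one_mul, Real.sqrt_eq_rpow, ← Real.rpow_add Real.pi_pos]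
    congr 1
    ring
  rw [hlast] at hswap
  rw [eq_div_iff hG.ne', hswap]

theorem integrable_poisson {q : ℝ} (hq : q = (Module.finrank ℝ V : ℝ) + 1) {h : ℝ} (hh : 0 < h) :
    Integrable (fun v : V => h * (h ^ 2 + ‖v‖ ^ 2) ^ (-q / 2)) := by
  simp_rw [scaled_one_add_norm_sq_rpow hq hh]
  exact ((integrable_one_add_norm_sq_rpow hq).comp_smul (inv_ne_zero hh.ne')).const_mul _

theorem integral_poisson {q : ℝ} (hq : q = (Module.finrank ℝ V : ℝ) + 1) {h : ℝ} (hh : 0 < h) :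
    ∫ v : V, h * (h ^ 2 + ‖v‖ ^ 2) ^ (-q / 2) = Real.pi ^ (q / 2) / Real.Gamma (q / 2) := by
  simp_rw [scaled_one_add_norm_sq_rpow hq hh]
  rw [integral_const_mul,
    Measure.integral_comp_inv_smul volume (fun v : V => (1 + ‖v‖ ^ 2) ^ (-q / 2)) h,
    integral_one_add_norm_sq_rpow hq, abs_of_pos (by positivity), smul_eq_mul, ← mul_assoc,
    inv_mul_cancel₀ (by positivity), one_mul]

/-- The mass of the Poisson kernel concentrates at the origin. -/
theorem tendsto_setIntegral_ball_poisson {q : ℝ} (hq : q = (Module.finrank ℝ V : ℝ) + 1) {δ : ℝ}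
    (hδ : 0 < δ) :
    Tendsto (fun h : ℝ => ∫ v in Metric.ball (0 : V) δ, h * (h ^ 2 + ‖v‖ ^ 2) ^ (-q / 2))
      (𝓝[>] 0) (𝓝 (Real.pi ^ (q / 2) / Real.Gamma (q / 2))) := by
  set c := Real.pi ^ (q / 2) / Real.Gamma (q / 2) with hc
  -- With this `k`, `k (1 + ‖v‖²) ≤ ‖v‖²` whenever `‖v‖ ≥ δ`, so outside the ball the kernel is at
  -- most `h` times a fixed integrable function.
  set k := δ ^ 2 / (1 + δ ^ 2) with hk
  have hkpos : 0 < k := by positivity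
  have hq0 : 0 ≤ q := by rw [hq]; positivity
  have hlow : ∀ h : ℝ, 0 < h → c - h * (k ^ (-q / 2) * c) ≤
      ∫ v in Metric.ball (0 : V) δ, h * (h ^ 2 + ‖v‖ ^ 2) ^ (-q / 2) := by
    intro h hh
    have hadd := integral_add_compl (μ := (volume : Measure V)) (s := Metric.ball (0 : V) δ)
      measurableSet_ball (integrable_poisson hq hh)
    rw [integral_poisson hq hh] at hadd
    have hle : ∫ v in (Metric.ball (0 : V) δ)ᶜ, h * (h ^ 2 + ‖v‖ ^ 2) ^ (-q / 2) ≤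
        h * (k ^ (-q / 2) * c) := by
      have hInt := ((integrable_one_add_norm_sq_rpow (V := V) hq).const_mul
        (k ^ (-q / 2))).const_mul h
      rw [hc, ← integral_one_add_norm_sq_rpow (V := V) hq, ← integral_const_mul,
        ← integral_const_mul]
      refine le_trans (setIntegral_mono_on (integrable_poisson hq hh).integrableOn
        hInt.integrableOn measurableSet_ball.compl fun v hv => ?_)
        (setIntegral_le_integral hInt (Eventually.of_forall fun v => by positivity))
      have hv' : δ ≤ ‖v‖ := by simpa using hv
      rw [← Real.mul_rpow hkpos.le (by positivity)]
      refine mul_le_mul_of_nonneg_left (Real.rpow_le_rpow_of_nonpos (by positivity) ?_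
        (by linarith)) hh.le
      have h2 : δ ^ 2 ≤ ‖v‖ ^ 2 := by gcongr
      rw [hk, div_mul_eq_mul_div, div_le_iff₀ (by positivity)]
      nlinarith [sq_nonneg h, sq_nonneg δ, mul_nonneg (sq_nonneg h) (sq_nonneg δ)]
    linarith
  have hup : ∀ h : ℝ, 0 < h →
      ∫ v in Metric.ball (0 : V) δ, h * (h ^ 2 + ‖v‖ ^ 2) ^ (-q / 2) ≤ c := by
    intro h hh
    rw [hc, ← integral_poisson (V := V) hq hh]
    exact setIntegral_le_integral (integrable_poisson hq hh)
      (Eventually.of_forall fun v => by positivity)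
  refine tendsto_of_tendsto_of_tendsto_of_le_of_le' (g := fun h => c - h * (k ^ (-q / 2) * c))
    (h := fun _ => c) ?_ tendsto_const_nhds ?_ ?_
  · have : Tendsto (fun h => c - h * (k ^ (-q / 2) * c)) (𝓝 0) (𝓝 (c - 0 * (k ^ (-q / 2) * c))) :=
      (by fun_prop : Continuous fun h => c - h * (k ^ (-q / 2) * c)).tendsto 0
    rw [zero_mul, sub_zero] at this
    exact this.mono_left nhdsWithin_le_nhds
  · filter_upwards [self_mem_nhdsWithin] with h hh using hlow h hh
  · filter_upwards [self_mem_nhdsWithin] with h hh using hup h hh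

/-- Integrability of `‖v‖ ^ (-β)` near the origin. -/
theorem integrableOn_ball_norm_rpow {β r : ℝ} (hd : 0 < Module.finrank ℝ V)
    (hβ : β < Module.finrank ℝ V) :
    IntegrableOn (fun v : V => ‖v‖ ^ (-β)) (Metric.ball 0 r) := by
  have : Nontrivial V := Module.nontrivial_of_finrank_pos hd
  rcases le_or_gt r 0 with hr | hr
  · simp [Metric.ball_eq_empty.2 hr]
  rw [integrableOn_fun_norm_addHaar volume (f := fun y : ℝ => y ^ (-β))]
  have h1 : IntegrableOn (fun y : ℝ => y ^ ((Module.finrank ℝ V : ℝ) - 1 - β)) (Set.Ioo 0 r) :=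
    (intervalIntegral.integrableOn_Ioo_rpow_iff hr).2 (by linarith)
  refine h1.congr_fun (fun y hy => ?_) measurableSet_Ioo
  simp only [smul_eq_mul]
  rw [← Real.rpow_natCast, ← Real.rpow_add hy.1, Nat.cast_sub (by omega)]
  push_cast
  ring_nf

end PoissonKernel

/-! ### Hausdorff measure on a surface against Lebesgue measure on a hyperplane -/

theorem LipschitzOnWith.euclideanHausdorffMeasure_image_le {X Y : Type*} [EMetricSpace X]
    [EMetricSpace Y] [MeasurableSpace X] [BorelSpace X] [MeasurableSpace Y] [BorelSpace Y]
    {K : NNReal} {f : X → Y} {s : Set X} (h : LipschitzOnWith K f s) (d : ℕ) :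
    μHE[d] (f '' s) ≤ (K : ENNReal) ^ d * μHE[d] s := by
  simp only [Measure.euclideanHausdorffMeasure_def, Measure.smul_apply, ENNReal.smul_def,
    smul_eq_mul]
  rw [mul_left_comm]
  gcongr
  simpa using h.hausdorffMeasure_image_le (d := d) (by positivity)

namespace SimpleLayer

section Projection

variable {m : ℕ} {e : EuclideanSpace ℝ (Fin m)}

theorem finrank_orthogonal_eq (he : ‖e‖ = 1) : Module.finrank ℝ (ℝ ∙ e)ᗮ = m - 1 := by
  have h1 := (ℝ ∙ e).finrank_add_finrank_orthogonal
  rw [finrank_span_singleton (by rintro rfl; simp at he), finrank_euclideanSpace_fin] at h1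
  omega

theorem norm_sq_eq_inner_sq_add (he : ‖e‖ = 1) (x : EuclideanSpace ℝ (Fin m)) :
    ‖x‖ ^ 2 = ⟪e, x⟫ ^ 2 + ‖(ℝ ∙ e)ᗮ.orthogonalProjectionOnto x‖ ^ 2 := by
  rw [Submodule.norm_sq_eq_add_norm_sq_projection x (ℝ ∙ e)]
  congr 1
  rw [show ‖(ℝ ∙ e).orthogonalProjectionOnto x‖ = ‖(ℝ ∙ e).starProjection x‖ from rfl,
    Submodule.starProjection_singleton,
    norm_smul, he]
  simp

/-- The surface `S` is compared with its orthogonal projection along `e`. -/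
theorem map_projection_le {S : Set (EuclideanSpace ℝ (Fin m))} (he : ‖e‖ = 1)
    (t : EuclideanSpace ℝ (Fin m)) {L : NNReal}
    (hL : ∀ x ∈ S, ∀ y ∈ S, ‖x - y‖ ≤ L * ‖(ℝ ∙ e)ᗮ.orthogonalProjectionOnto (x - y)‖) :
    ((μHE[m - 1] : Measure (EuclideanSpace ℝ (Fin m))).restrict S).map
      (fun ξ => (ℝ ∙ e)ᗮ.orthogonalProjectionOnto (ξ - t)) ≤ (L : ENNReal) ^ (m - 1) • volume := by
  set g : EuclideanSpace ℝ (Fin m) → (ℝ ∙ e)ᗮ :=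
    fun ξ => (ℝ ∙ e)ᗮ.orthogonalProjectionOnto (ξ - t) with hg
  have hgm : Measurable g := (by fun_prop : Continuous g).measurable
  refine Measure.le_iff.2 fun A hA => ?_
  rw [Measure.map_apply hgm hA, Measure.restrict_apply (hgm hA), Measure.smul_apply, smul_eq_mul,
    ← InnerProductSpace.euclideanHausdorffMeasure_eq_volume, finrank_orthogonal_eq he]
  set T := g ⁻¹' A ∩ S with hT
  have hsub : ∀ x y, g x - g y = (ℝ ∙ e)ᗮ.orthogonalProjectionOnto (x - y) := fun x y => by
    rw [hg, ← map_sub, sub_sub_sub_cancel_right]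
  have hinj : Set.InjOn g T := by
    intro x hx y hy hxy
    have := hL x hx.2 y hy.2
    rw [← hsub, hxy, sub_self, norm_zero, mul_zero] at this
    exact sub_eq_zero.1 (norm_le_zero_iff.1 this)
  -- By `hL` the inverse of the projection on `T` is `L`-Lipschitz, and `T` is the image under it of
  -- a subset of `A`. Both measure estimates hold for arbitrary sets, so the image `g '' T` need not
  -- be measurable.
  have hlip : LipschitzOnWith L (Function.invFunOn g T) (g '' T) := by
    refine LipschitzOnWith.of_dist_le_mul ?_
    rintro _ ⟨x, hx, rfl⟩ _ ⟨y, hy, rfl⟩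
    rw [hinj.leftInvOn_invFunOn hx, hinj.leftInvOn_invFunOn hy, dist_eq_norm, dist_eq_norm, hsub]
    exact hL x hx.2 y hy.2
  have himg : Function.invFunOn g T '' (g '' T) = T := hinj.leftInvOn_invFunOn.image_image
  calc μHE[m - 1] T = μHE[m - 1] (Function.invFunOn g T '' (g '' T)) := by rw [himg]
    _ ≤ (L : ENNReal) ^ (m - 1) * μHE[m - 1] (g '' T) :=
      hlip.euclideanHausdorffMeasure_image_le _
    _ ≤ _ := by
      gcongr
      rintro _ ⟨x, hx, rfl⟩
      exact hx.1

/-- The projection is 1-Lipschitz, so it does not increase Hausdorff measure, and every point of `D`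
is hit from `S`. -/
theorem restrict_le_map_projection {S : Set (EuclideanSpace ℝ (Fin m))} (he : ‖e‖ = 1)
    (t : EuclideanSpace ℝ (Fin m)) {D : Set (ℝ ∙ e)ᗮ}
    (hD : D ⊆ (fun ξ => (ℝ ∙ e)ᗮ.orthogonalProjectionOnto (ξ - t)) '' S) :
    volume.restrict D ≤ ((μHE[m - 1] : Measure (EuclideanSpace ℝ (Fin m))).restrict S).map
      (fun ξ => (ℝ ∙ e)ᗮ.orthogonalProjectionOnto (ξ - t)) := by
  set g : EuclideanSpace ℝ (Fin m) → (ℝ ∙ e)ᗮ :=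
    fun ξ => (ℝ ∙ e)ᗮ.orthogonalProjectionOnto (ξ - t) with hg
  have hgm : Measurable g := (by fun_prop : Continuous g).measurable
  refine Measure.le_iff.2 fun A hA => ?_
  rw [Measure.map_apply hgm hA, Measure.restrict_apply (hgm hA), Measure.restrict_apply hA,
    ← InnerProductSpace.euclideanHausdorffMeasure_eq_volume, finrank_orthogonal_eq he]
  have hlip : LipschitzWith 1 g := by
    refine LipschitzWith.of_dist_le_mul fun x y => ?_
    rw [dist_eq_norm, dist_eq_norm, hg, ← map_sub, sub_sub_sub_cancel_right, NNReal.coe_one,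
      one_mul]
    exact Submodule.norm_orthogonalProjectionOnto_apply_le _ _
  calc μHE[m - 1] (A ∩ D) ≤ μHE[m - 1] (g '' (g ⁻¹' A ∩ S)) := by
        refine measure_mono ?_
        rintro y ⟨hyA, hyD⟩
        obtain ⟨x, hx, rfl⟩ := hD hyD
        exact ⟨x, ⟨hyA, hx⟩, rfl⟩
    _ ≤ _ := by
      simpa using hlip.lipschitzOnWith.euclideanHausdorffMeasure_image_le (m - 1)

end Projection

variable {m : ℕ} [NeZero m] {Ω : Set (EuclideanSpace ℝ (Fin m))}
  {n : EuclideanSpace ℝ (Fin m) → EuclideanSpace ℝ (Fin m)}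

/-! ### Flatness of `Γ` and integrals over `Γ` -/

namespace IsLyapunovDomain

/-- In small balls, of radius independent of the centre, `Γ` is almost flat. -/
theorem exists_radius_norm_sub_le (hΩ : IsLyapunovDomain Ω n)
    {L : NNReal} (hL : 1 < L) : ∃ δ > 0, ∀ t ∈ surf Ω,
    ∀ x ∈ surf Ω ∩ Metric.ball t δ, ∀ y ∈ surf Ω ∩ Metric.ball t δ,
      ‖x - y‖ ≤ L * ‖(ℝ ∙ n t)ᗮ.orthogonalProjectionOnto (x - y)‖ := by
  obtain ⟨a, κ, ha, hκ, -, hn⟩ := hΩ.exists_holder_normal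
  have hL' : (1 : ℝ) < L := by exact_mod_cast hL
  have hε : 0 < 1 - ((L : ℝ) ^ 2)⁻¹ := sub_pos.2 (inv_lt_one_of_one_lt₀ (by nlinarith))
  have htend : Tendsto (fun δ : ℝ => (a * δ ^ κ) ^ 2) (𝓝[>] 0) (𝓝 0) := by
    have : Tendsto (fun δ : ℝ => (a * δ ^ κ) ^ 2) (𝓝 0) (𝓝 ((a * 0 ^ κ) ^ 2)) :=
      ((continuous_const.mul (Real.continuous_rpow_const hκ.le)).pow 2).tendsto 0
    rw [Real.zero_rpow hκ.ne', mul_zero, zero_pow two_ne_zero] at this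
    exact this.mono_left nhdsWithin_le_nhds
  -- The normal component of a chord inside the ball is at most `a δ^κ` times its length. Requiring
  -- `(a δ^κ)² < 1 - L⁻²` leaves, by Pythagoras, a tangential component of at least `L⁻¹` times the
  -- length.
  obtain ⟨δ, hδε, hδ⟩ := ((htend.eventually (gt_mem_nhds hε)).and self_mem_nhdsWithin).exists
  refine ⟨δ, hδ, fun t ht x hx y hy => ?_⟩
  have h1 : |⟪n t, x - y⟫| ≤ a * δ ^ κ * ‖x - y‖ := by
    refine hΩ.abs_inner_le_of_normal_close hy.1 hx.1 fun z hz => ?_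
    refine (hn z hz.1 t ht).trans ?_
    have := (convex_ball t δ).segment_subset hy.2 hx.2 hz.2
    have := (Metric.mem_ball.1 this).le
    gcongr
  have h2 := norm_sq_eq_inner_sq_add (hΩ.norm_normal ht) (x - y)
  have h3 : ⟪n t, x - y⟫ ^ 2 ≤ (1 - ((L : ℝ) ^ 2)⁻¹) * ‖x - y‖ ^ 2 := by
    rw [← sq_abs]
    calc |⟪n t, x - y⟫| ^ 2 ≤ (a * δ ^ κ * ‖x - y‖) ^ 2 := by gcongr
      _ = (a * δ ^ κ) ^ 2 * ‖x - y‖ ^ 2 := by ring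
      _ ≤ _ := by gcongr
  have h4 : ((L : ℝ) ^ 2)⁻¹ * ‖x - y‖ ^ 2 ≤
      ‖(ℝ ∙ n t)ᗮ.orthogonalProjectionOnto (x - y)‖ ^ 2 := by linarith
  rw [inv_mul_le_iff₀ (by positivity), ← mul_pow] at h4
  exact (abs_le_of_sq_le_sq' h4 (by positivity)).2

/-- `Γ` need not be compact, since its closure may reach the hyperplane. It is still totally
bounded, and the radius of flatness does not depend on the centre, so finitely many balls centred on
`Γ` suffice, each meeting `Γ` in a set comparable with a disc. -/
theorem isFiniteMeasure_surfMeasure (hΩ : IsLyapunovDomain Ω n)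
    : IsFiniteMeasure (surfMeasure Ω) := by
  obtain ⟨δ, hδ, hflat⟩ := hΩ.exists_radius_norm_sub_le (L := 2) (by norm_num)
  have htb : TotallyBounded (surf Ω) :=
    (Metric.isCompact_of_isClosed_isBounded isClosed_closure
      hΩ.isBounded_surf.closure).totallyBounded.subset subset_closure
  obtain ⟨F, hFs, hF, hcov⟩ := Metric.finite_approx_of_totallyBounded htb δ hδ
  have hball : ∀ t ∈ surf Ω, μHE[m - 1] (surf Ω ∩ Metric.ball t δ) < ⊤ := by
    intro t ht
    have hle := map_projection_le (hΩ.norm_normal ht) t (hflat t ht)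
    set g : EuclideanSpace ℝ (Fin m) → (ℝ ∙ n t)ᗮ :=
      fun ξ => (ℝ ∙ n t)ᗮ.orthogonalProjectionOnto (ξ - t) with hg
    have hgm : Measurable g := (by fun_prop : Continuous g).measurable
    have h1 := hle (Metric.ball 0 δ)
    rw [Measure.map_apply hgm measurableSet_ball, Measure.restrict_apply (hgm measurableSet_ball),
      Measure.smul_apply, smul_eq_mul] at h1
    refine lt_of_le_of_lt ((measure_mono ?_).trans h1)
      (ENNReal.mul_lt_top (by simp) measure_ball_lt_top)
    intro x hx
    refine ⟨?_, hx⟩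
    rw [Set.mem_preimage, mem_ball_zero_iff]
    refine (Submodule.norm_orthogonalProjectionOnto_apply_le _ _).trans_lt ?_
    simpa [dist_eq_norm] using hx.2
  refine ⟨?_⟩
  rw [surfMeasure, Measure.restrict_apply_univ]
  refine lt_of_le_of_lt (measure_mono (t := ⋃ t ∈ F, surf Ω ∩ Metric.ball t δ) ?_) ?_
  · intro x hx
    obtain ⟨t, ht, hxt⟩ := Set.mem_iUnion₂.1 (hcov hx)
    exact Set.mem_iUnion₂.2 ⟨t, ht, hx, hxt⟩
  · exact measure_biUnion_lt_top hF fun t ht => hball t (hFs ht)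

/-- Near `t` the power is dominated by the same power of the projection, integrable on the tangent
plane of dimension `m - 1`; away from `t` it is bounded. This supplies the dominating functions for
the weakly singular kernels. -/
theorem integrable_norm_sub_rpow (hΩ : IsLyapunovDomain Ω n)
    (hm : 2 < m) {t : EuclideanSpace ℝ (Fin m)} (ht : t ∈ surf Ω)
    {β : ℝ} (hβ₀ : 0 ≤ β) (hβ : β < (m : ℝ) - 1) :
    Integrable (fun ξ => ‖ξ - t‖ ^ (-β)) (surfMeasure Ω) := by
  have := hΩ.isFiniteMeasure_surfMeasure
  obtain ⟨δ, hδ, hflat⟩ := hΩ.exists_radius_norm_sub_le (L := 2) (by norm_num)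
  have hle := map_projection_le (hΩ.norm_normal ht) t (hflat t ht)
  set g : EuclideanSpace ℝ (Fin m) → (ℝ ∙ n t)ᗮ :=
    fun ξ => (ℝ ∙ n t)ᗮ.orthogonalProjectionOnto (ξ - t) with hg
  have hgm : Measurable g := (by fun_prop : Continuous g).measurable
  have hmeas : Measurable fun ξ : EuclideanSpace ℝ (Fin m) => ‖ξ - t‖ ^ (-β) := by fun_prop
  have hrank := finrank_orthogonal_eq (hΩ.norm_normal ht)
  rw [← integrableOn_univ, ← Set.union_compl_self (Metric.ball t δ), integrableOn_union]
  constructor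
  · have h1 : Integrable ((Metric.ball (0 : (ℝ ∙ n t)ᗮ) δ).indicator fun v => ‖v‖ ^ (-β))
        (((μHE[m - 1] : Measure (EuclideanSpace ℝ (Fin m))).restrict
          (surf Ω ∩ Metric.ball t δ)).map g) := by
      refine Integrable.mono_measure ?_ hle
      refine Integrable.smul_measure ?_ (by simp)
      rw [integrable_indicator_iff measurableSet_ball]
      refine integrableOn_ball_norm_rpow (by omega) ?_
      rw [hrank, Nat.cast_sub (by omega)]
      simpa using hβ
    have h2 := h1.comp_measurable hgm
    rw [IntegrableOn, surfMeasure, Measure.restrict_restrict measurableSet_ball, Set.inter_comm]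
    refine h2.mono' hmeas.aestronglyMeasurable ?_
    refine (ae_restrict_mem (measurableSet_surf.inter measurableSet_ball)).mono fun ξ hξ => ?_
    have h3 : ‖g ξ‖ ≤ ‖ξ - t‖ := Submodule.norm_orthogonalProjectionOnto_apply_le _ _
    have h4 : ‖ξ - t‖ < δ := by simpa [dist_eq_norm] using hξ.2
    have h5 := hflat t ht ξ hξ t ⟨ht, Metric.mem_ball_self hδ⟩
    rw [Function.comp_apply, Set.indicator_of_mem (by simpa using h3.trans_lt h4),
      Real.norm_of_nonneg (by positivity)]
    -- A negative power of 0 is 0 by convention, so monotonicity is not available there. By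
    -- flatness, a vanishing projection forces `ξ = t`, and the two sides agree.
    rcases (norm_nonneg (g ξ)).eq_or_lt with h | h
    · have : ‖ξ - t‖ = 0 := by
        refine le_antisymm ?_ (norm_nonneg _)
        change ‖ξ - t‖ ≤ _ * ‖g ξ‖ at h5
        rwa [← h, mul_zero] at h5
      rw [this, ← h]
    · exact Real.rpow_le_rpow_of_nonpos h h3 (by linarith)
  · refine Measure.integrableOn_of_bounded (M := δ ^ (-β)) (measure_ne_top _ _)
      hmeas.aestronglyMeasurable ?_
    refine (ae_restrict_mem measurableSet_ball.compl).mono fun ξ hξ => ?_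
    have h4 : δ ≤ ‖ξ - t‖ := by simpa [dist_eq_norm] using hξ
    rw [Real.norm_of_nonneg (by positivity)]
    exact Real.rpow_le_rpow_of_nonpos hδ h4 (by linarith)

theorem integrable_poisson_surf (hΩ : IsLyapunovDomain Ω n)
    {q : ℝ} (hq : 0 ≤ q) (t : EuclideanSpace ℝ (Fin m)) {h : ℝ}
    (hh : 0 < h) : Integrable (fun ξ => h * (h ^ 2 + ‖ξ - t‖ ^ 2) ^ (-q / 2)) (surfMeasure Ω) := by
  have := hΩ.isFiniteMeasure_surfMeasure
  have hmeas : Measurable fun ξ : EuclideanSpace ℝ (Fin m) =>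
      h * (h ^ 2 + ‖ξ - t‖ ^ 2) ^ (-q / 2) := by fun_prop
  refine Integrable.of_bound hmeas.aestronglyMeasurable (h * (h ^ 2) ^ (-q / 2))
    (Eventually.of_forall fun ξ => ?_)
  rw [Real.norm_of_nonneg (by positivity)]
  refine mul_le_mul_of_nonneg_left (Real.rpow_le_rpow_of_nonpos (by positivity) ?_
    (by linarith)) hh.le
  nlinarith [sq_nonneg ‖ξ - t‖]

theorem setIntegral_compl_ball_poisson_surf_le (hΩ : IsLyapunovDomain Ω n) {q : ℝ} (hq : 0 ≤ q)
    (t : EuclideanSpace ℝ (Fin m)) {h δ : ℝ} (hh : 0 < h) (hδ : 0 < δ) :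
    ∫ ξ in (Metric.ball t δ)ᶜ, h * (h ^ 2 + ‖ξ - t‖ ^ 2) ^ (-q / 2) ∂(surfMeasure Ω) ≤
      h * ((δ ^ 2) ^ (-q / 2) * (surfMeasure Ω).real Set.univ) := by
  have := hΩ.isFiniteMeasure_surfMeasure
  calc ∫ ξ in (Metric.ball t δ)ᶜ, h * (h ^ 2 + ‖ξ - t‖ ^ 2) ^ (-q / 2) ∂(surfMeasure Ω)
      ≤ ∫ ξ in (Metric.ball t δ)ᶜ, h * (δ ^ 2) ^ (-q / 2) ∂(surfMeasure Ω) := by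
        refine setIntegral_mono_on (hΩ.integrable_poisson_surf hq t hh).integrableOn
          (integrable_const _) measurableSet_ball.compl fun ξ hξ => ?_
        have h4 : δ ≤ ‖ξ - t‖ := by simpa [dist_eq_norm] using hξ
        refine mul_le_mul_of_nonneg_left (Real.rpow_le_rpow_of_nonpos (by positivity) ?_
          (by linarith)) hh.le
        nlinarith [sq_nonneg h]
    _ ≤ ∫ ξ, h * (δ ^ 2) ^ (-q / 2) ∂(surfMeasure Ω) :=
        setIntegral_le_integral (integrable_const _)
          (Eventually.of_forall fun v => by positivity)
    _ = _ := by
        rw [integral_const, smul_eq_mul]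
        ring

/-- The Poisson kernel with pole at a point of `Γ`, integrated over `Γ`. -/
theorem tendsto_integral_poisson_surf (hΩ : IsLyapunovDomain Ω n)
    (hm : 2 < m) {t : EuclideanSpace ℝ (Fin m)}
    (ht : t ∈ surf Ω) :
    Tendsto (fun h : ℝ => ∫ ξ, h * (h ^ 2 + ‖ξ - t‖ ^ 2) ^ (-(m : ℝ) / 2) ∂(surfMeasure Ω))
      (𝓝[>] 0) (𝓝 (Real.pi ^ ((m : ℝ) / 2) / Real.Gamma ((m : ℝ) / 2))) := by
  have := hΩ.isFiniteMeasure_surfMeasure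
  have hnt := hΩ.norm_normal ht
  have hrank := finrank_orthogonal_eq hnt
  have hq : (m : ℝ) = (Module.finrank ℝ (ℝ ∙ n t)ᗮ : ℝ) + 1 := by
    rw [hrank, Nat.cast_sub (by omega)]
    simp
  set c := Real.pi ^ ((m : ℝ) / 2) / Real.Gamma ((m : ℝ) / 2) with hc
  have hcpos : 0 < c := by
    have := Real.Gamma_pos_of_pos (s := (m : ℝ) / 2) (by positivity)
    have := Real.pi_pos
    positivity
  set P : ℝ → EuclideanSpace ℝ (Fin m) → ℝ :=
    fun h ξ => h * (h ^ 2 + ‖ξ - t‖ ^ 2) ^ (-(m : ℝ) / 2) with hP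
  set p : ℝ → (ℝ ∙ n t)ᗮ → ℝ := fun h v => h * (h ^ 2 + ‖v‖ ^ 2) ^ (-(m : ℝ) / 2) with hp
  have hm0 : -(m : ℝ) / 2 ≤ 0 := by
    have : (0 : ℝ) ≤ m := by positivity
    linarith
  set g : EuclideanSpace ℝ (Fin m) → (ℝ ∙ n t)ᗮ :=
    fun ξ => (ℝ ∙ n t)ᗮ.orthogonalProjectionOnto (ξ - t) with hg
  have hgm : Measurable g := (by fun_prop : Continuous g).measurable
  have hgle : ∀ ξ, ‖g ξ‖ ≤ ‖ξ - t‖ := fun ξ => Submodule.norm_orthogonalProjectionOnto_apply_le _ _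
  have hpm : ∀ h, Measurable (p h) := fun h => by simp only [hp]; fun_prop
  have hPint : ∀ h, 0 < h → Integrable (P h) (surfMeasure Ω) := fun h hh =>
    hΩ.integrable_poisson_surf (by positivity) t hh
  -- Replacing `ξ - t` by its projection increases the kernel, and since `h² + ‖ξ - t‖² ≤ L² (h² +
  -- ‖g ξ‖²)` by at most a factor `L^m`. The change of measure costs a factor `L^(m-1)` in the upper
  -- bound only; the lower bound uses the mass `ψ h` of a disc covered by the projection. Afterwards
  -- `L` is fixed close to 1 before `h → 0`.
  have hmain : ∀ L : NNReal, 1 < L → ∃ M : ℝ, ∃ ψ : ℝ → ℝ, Tendsto ψ (𝓝[>] 0) (𝓝 c) ∧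
      ∀ h, 0 < h → ∫ ξ, P h ξ ∂(surfMeasure Ω) ≤ (L : ℝ) ^ (m - 1) * c + h * M ∧
        ((L : ℝ) ^ 2) ^ (-(m : ℝ) / 2) * ψ h ≤ ∫ ξ, P h ξ ∂(surfMeasure Ω) := by
    intro L hL
    have hL1 : (1 : ℝ) < L := by exact_mod_cast hL
    obtain ⟨δ, hδ, hflat⟩ := hΩ.exists_radius_norm_sub_le hL
    have hle := map_projection_le hnt t (hflat t ht)
    obtain ⟨δ', hδ', hdisc⟩ := hΩ.exists_disc_subset_projection ht hδ
    have hge := restrict_le_map_projection (S := surf Ω ∩ Metric.ball t δ) hnt t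
      (D := Metric.ball 0 δ') (by
        intro y hy
        obtain ⟨s, hs⟩ := hdisc (y : EuclideanSpace ℝ (Fin m)) (by simpa using hy)
        refine ⟨_, hs, ?_⟩
        have h1 : (ℝ ∙ n t)ᗮ.orthogonalProjectionOnto (n t) = 0 :=
          Submodule.orthogonalProjectionOnto_apply_of_mem_orthogonal (by
            rw [Submodule.orthogonal_orthogonal]
            exact Submodule.mem_span_singleton_self _)
        simp only [add_assoc, add_sub_cancel_left, map_add, map_smul, h1, smul_zero, add_zero]
        exact Submodule.orthogonalProjectionOnto_mem_subspace_eq_self y)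
    rw [← hg] at hle hge
    set μ := (μHE[m - 1] : Measure (EuclideanSpace ℝ (Fin m))).restrict (surf Ω ∩ Metric.ball t δ)
      with hμ
    have hμ' : (surfMeasure Ω).restrict (Metric.ball t δ) = μ := by
      rw [surfMeasure, Measure.restrict_restrict measurableSet_ball, Set.inter_comm]
    have hpL : ∀ h, 0 < h → Integrable (p h) ((L : ENNReal) ^ (m - 1) • volume) := fun h hh =>
      (integrable_poisson hq hh).smul_measure (by simp)
    have hpg : ∀ h, 0 < h → Integrable (fun ξ => p h (g ξ)) μ := fun h hh =>
      ((hpL h hh).mono_measure hle).comp_measurable hgm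
    have hmap : ∀ h, ∫ ξ, p h (g ξ) ∂μ = ∫ v, p h v ∂(μ.map g) := fun h =>
      (integral_map hgm.aemeasurable (hpm h).aestronglyMeasurable).symm
    have hPball : ∀ h, 0 < h → Integrable (P h) μ := fun h hh => by
      rw [← hμ']; exact (hPint h hh).integrableOn
    refine ⟨(δ ^ 2) ^ (-(m : ℝ) / 2) * (surfMeasure Ω).real Set.univ,
      fun h => ∫ v in Metric.ball (0 : (ℝ ∙ n t)ᗮ) δ', p h v,
      tendsto_setIntegral_ball_poisson hq hδ', fun h hh => ⟨?_, ?_⟩⟩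
    · rw [← integral_add_compl (measurableSet_ball (x := t) (ε := δ)) (hPint h hh), hμ']
      refine add_le_add ?_ ?_
      · calc ∫ ξ, P h ξ ∂μ ≤ ∫ ξ, p h (g ξ) ∂μ := by
              refine integral_mono (hPball h hh) (hpg h hh) fun ξ => ?_
              refine mul_le_mul_of_nonneg_left (Real.rpow_le_rpow_of_nonpos (by positivity) ?_ hm0)
                hh.le
              have := hgle ξ
              gcongr
          _ = ∫ v, p h v ∂(μ.map g) := hmap h
          _ ≤ ∫ v, p h v ∂((L : ENNReal) ^ (m - 1) • volume) :=
              integral_mono_measure hle (Eventually.of_forall fun v => by positivity) (hpL h hh)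
          _ = (L : ℝ) ^ (m - 1) * c := by
              rw [integral_smul_measure, integral_poisson hq hh]
              simp [hc]
      · exact hΩ.setIntegral_compl_ball_poisson_surf_le (by positivity) t hh hδ
    · calc ((L : ℝ) ^ 2) ^ (-(m : ℝ) / 2) * ∫ v in Metric.ball (0 : (ℝ ∙ n t)ᗮ) δ', p h v
          ≤ ((L : ℝ) ^ 2) ^ (-(m : ℝ) / 2) * ∫ v, p h v ∂(μ.map g) := by
            refine mul_le_mul_of_nonneg_left ?_ (by positivity)
            exact integral_mono_measure hge (Eventually.of_forall fun v => by positivity)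
              ((hpL h hh).mono_measure hle)
        _ = ∫ ξ, ((L : ℝ) ^ 2) ^ (-(m : ℝ) / 2) * p h (g ξ) ∂μ := by
            rw [← hmap]
            exact (integral_const_mul _ _).symm
        _ ≤ ∫ ξ, P h ξ ∂μ := by
            refine integral_mono_ae ((hpg h hh).const_mul _) (hPball h hh) ?_
            refine (ae_restrict_mem (measurableSet_surf.inter measurableSet_ball)).mono
              fun ξ hξ => ?_
            have h5 := hflat t ht ξ hξ t ⟨ht, Metric.mem_ball_self hδ⟩
            change ‖ξ - t‖ ≤ L * ‖g ξ‖ at h5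
            simp only [hp, hP]
            rw [mul_left_comm, ← Real.mul_rpow (by positivity) (by positivity)]
            refine mul_le_mul_of_nonneg_left (Real.rpow_le_rpow_of_nonpos (by positivity) ?_ hm0)
              hh.le
            have h6 : ‖ξ - t‖ ^ 2 ≤ (L * ‖g ξ‖) ^ 2 := by gcongr
            have h7 : (1 : ℝ) ≤ (L : ℝ) ^ 2 := by nlinarith
            nlinarith [sq_nonneg h]
        _ ≤ ∫ ξ, P h ξ ∂(surfMeasure Ω) := by
            rw [← hμ']
            exact setIntegral_le_integral (hPint h hh)
              (Eventually.of_forall fun v => by positivity)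
  have hgt1 : ∀ᶠ L : NNReal in 𝓝[>] 1, 1 < L := self_mem_nhdsWithin
  refine tendsto_order.2 ⟨fun b hb => ?_, fun b hb => ?_⟩
  · have hcont : Tendsto (fun L : NNReal => ((L : ℝ) ^ 2) ^ (-(m : ℝ) / 2) * c) (𝓝[>] 1) (𝓝 c) := by
      have : ContinuousAt (fun L : NNReal => ((L : ℝ) ^ 2) ^ (-(m : ℝ) / 2) * c) 1 :=
        (ContinuousAt.rpow_const (by fun_prop) (by simp)).mul_const c
      have h2 := this.tendsto
      simp only [NNReal.coe_one, one_pow, Real.one_rpow, one_mul] at h2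
      exact h2.mono_left nhdsWithin_le_nhds
    obtain ⟨L, hL1, hL⟩ := ((hcont.eventually (lt_mem_nhds hb)).and hgt1).exists
    obtain ⟨M, ψ, hψ, hbound⟩ := hmain L hL
    filter_upwards [(hψ.const_mul (((L : ℝ) ^ 2) ^ (-(m : ℝ) / 2))).eventually (lt_mem_nhds hL1),
      self_mem_nhdsWithin] with h h1 h2
    exact h1.trans_le (hbound h h2).2
  · have hcont : Tendsto (fun L : NNReal => (L : ℝ) ^ (m - 1) * c) (𝓝[>] 1) (𝓝 c) := by
      have : Continuous (fun L : NNReal => (L : ℝ) ^ (m - 1) * c) := by fun_prop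
      have h2 := this.tendsto 1
      simp only [NNReal.coe_one, one_pow, one_mul] at h2
      exact h2.mono_left nhdsWithin_le_nhds
    obtain ⟨L, hL1, hL⟩ := ((hcont.eventually (gt_mem_nhds hb)).and hgt1).exists
    obtain ⟨M, ψ, hψ, hbound⟩ := hmain L hL
    have hlim : Tendsto (fun h : ℝ => (L : ℝ) ^ (m - 1) * c + h * M) (𝓝[>] 0)
        (𝓝 ((L : ℝ) ^ (m - 1) * c)) := by
      have h3 := (by fun_prop : Continuous fun h : ℝ => (L : ℝ) ^ (m - 1) * c + h * M).tendsto 0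
      rw [zero_mul, add_zero] at h3
      exact h3.mono_left nhdsWithin_le_nhds
    filter_upwards [hlim.eventually (gt_mem_nhds hL1), self_mem_nhdsWithin] with h h1 h2
    exact (hbound h h2).1.trans_lt h1

end IsLyapunovDomain

/-! ### Euler's integral: transformation and derivatives -/

section EulerIntegral

/-- Euler's integral in the variable `w`. -/
noncomputable def eulerJ (u v e w : ℝ) : ℝ :=
  ∫ τ in (0 : ℝ)..1, τ ^ (u - 1) * (1 - τ) ^ (v - 1) * (1 - w * τ) ^ e

/-- Euler's integral with the homogeneous kernel `(ρ + b τ) ^ (-p)`. -/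
noncomputable def eulerW (u v p ρ b : ℝ) : ℝ :=
  ∫ τ in (0 : ℝ)..1, τ ^ (u - 1) * (1 - τ) ^ (v - 1) * (ρ + b * τ) ^ (-p)

theorem weight_nonneg (u v : ℝ) {τ : ℝ} (hτ : τ ∈ Set.uIoc (0 : ℝ) 1) :
    0 ≤ τ ^ (u - 1) * (1 - τ) ^ (v - 1) := by
  rw [Set.uIoc_of_le zero_le_one] at hτ
  exact mul_nonneg (Real.rpow_nonneg hτ.1.le _) (Real.rpow_nonneg (by linarith [hτ.2]) _)

/-- For `e ≥ 0` the last factor is at most 1, so the beta weight dominates up to and including `w =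
1`. That endpoint corresponds to `r = 0` and determines the coefficient of the leading singularity.
-/
theorem continuousOn_eulerJ {u v : ℝ} (hu : 0 < u) (hv : 0 < v) {e : ℝ} (he : 0 ≤ e) :
    ContinuousOn (eulerJ u v e) (Set.Icc 0 1) := by
  intro w hw
  refine intervalIntegral.continuousWithinAt_of_dominated_interval
    (bound := fun τ => τ ^ (u - 1) * (1 - τ) ^ (v - 1)) ?_ ?_ (real_beta hu hv).1 ?_
  · exact Eventually.of_forall fun w => (by fun_prop : Measurable _).aestronglyMeasurable
  · filter_upwards [self_mem_nhdsWithin] with w hw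
    refine Eventually.of_forall fun τ hτ => ?_
    have h0 := weight_nonneg u v hτ
    rw [Set.uIoc_of_le zero_le_one] at hτ
    have h1 : 0 ≤ 1 - w * τ := by nlinarith [hw.1, hw.2, hτ.1, hτ.2]
    have h2 : 1 - w * τ ≤ 1 := by nlinarith [hw.1, hw.2, hτ.1, hτ.2]
    have h3 := Real.rpow_nonneg h1 e
    rw [Real.norm_of_nonneg (mul_nonneg h0 h3)]
    exact mul_le_of_le_one_right h0 (Real.rpow_le_one h1 h2 he)
  · refine Eventually.of_forall fun τ hτ => ContinuousAt.continuousWithinAt ?_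
    exact continuousAt_const.mul ((Real.continuous_rpow_const he).continuousAt.comp (by fun_prop))

theorem eulerJ_one {u v : ℝ} (hu : 0 < u) (hv : 0 < v) {e : ℝ} (he : 0 ≤ e) :
    eulerJ u v e 1 = Real.Gamma u * Real.Gamma (v + e) / Real.Gamma (u + (v + e)) := by
  rw [← (real_beta hu (by linarith : 0 < v + e)).2, eulerJ,
    intervalIntegral.integral_of_le zero_le_one, intervalIntegral.integral_of_le zero_le_one,
    integral_Ioc_eq_integral_Ioo, integral_Ioc_eq_integral_Ioo]
  refine setIntegral_congr_fun measurableSet_Ioo fun τ hτ => ?_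
  have h1 : 0 < 1 - τ := by linarith [hτ.2]
  simp only [one_mul]
  rw [mul_assoc, ← Real.rpow_add h1]
  congr 2
  ring

/-- This is Pfaff's transformation of the hypergeometric function. The behaviour as `ρ → 0` becomes
an explicit power, and the exponent `p - u - v` in `eulerJ` is nonnegative in all the applications.
-/
theorem eulerW_eq_eulerJ (u v p : ℝ) {ρ b : ℝ} (hρ : 0 < ρ) (hb : 0 ≤ b) :
    eulerW u v p ρ b = ρ ^ (u - p) * (ρ + b) ^ (-u) * eulerJ u v (p - u - v) (b / (ρ + b)) := by
  set l := ρ / (ρ + b) with hl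
  set w := b / (ρ + b) with hw
  have hs : 0 < ρ + b := by linarith
  have hl0 : 0 < l := by positivity
  have hw0 : 0 ≤ w := by positivity
  have hlw : l = 1 - w := by rw [hl, hw]; field_simp; ring
  -- A Möbius map of the unit interval fixing 0 and 1. It makes `1 - φ σ` and `ρ + b φ σ` equal to
  -- `1 - σ` and `ρ`, each divided by `1 - w σ`, so all factors recombine.
  set φ : ℝ → ℝ := fun σ => l * σ / (1 - w * σ) with hφ
  have hD : ∀ σ ∈ Set.Ioo (0 : ℝ) 1, 0 < 1 - w * σ := by
    intro σ hσ
    nlinarith [hσ.1, hσ.2]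
  have himg : φ '' Set.Ioo 0 1 = Set.Ioo 0 1 := by
    ext τ
    constructor
    · rintro ⟨σ, hσ, rfl⟩
      have hd := hD σ hσ
      refine ⟨div_pos (mul_pos hl0 hσ.1) hd, ?_⟩
      rw [hφ, div_lt_one hd, hlw]
      linarith [hσ.2]
    · intro hτ
      have hd : 0 < l + w * τ := by nlinarith [hτ.1]
      refine ⟨τ / (l + w * τ), ⟨div_pos hτ.1 hd, ?_⟩, ?_⟩
      · rw [div_lt_one hd]
        nlinarith [hτ.1, hτ.2]
      · have h1 : 1 - w * (τ / (l + w * τ)) = l / (l + w * τ) := by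
          field_simp
          ring
        simp only [hφ]
        rw [h1, div_eq_iff (by positivity)]
        ring
  have hder : ∀ σ ∈ Set.Ioo (0 : ℝ) 1,
      HasDerivWithinAt φ (l / (1 - w * σ) ^ 2) (Set.Ioo 0 1) σ := by
    intro σ hσ
    have hd := (hD σ hσ).ne'
    have h1 : HasDerivAt (fun σ : ℝ => l * σ) l σ := by
      simpa using (hasDerivAt_id σ).const_mul l
    have h2 : HasDerivAt (fun σ : ℝ => 1 - w * σ) (-w) σ := by
      simpa using ((hasDerivAt_id σ).const_mul w).const_sub 1
    have h3 := (h1.div h2 hd).hasDerivWithinAt (s := Set.Ioo 0 1)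
    refine h3.congr_deriv ?_
    congr 1
    ring
  have hinj : Set.InjOn φ (Set.Ioo 0 1) := by
    intro σ hσ τ hτ h
    have h1 := (hD σ hσ).ne'
    have h2 := (hD τ hτ).ne'
    simp only [hφ] at h
    rw [div_eq_div_iff h1 h2] at h
    have h3 : l * (σ - τ) = 0 := by linarith
    have := (mul_eq_zero.1 h3).resolve_left hl0.ne'
    linarith
  have hcov := integral_image_eq_integral_abs_deriv_smul measurableSet_Ioo hder hinj
    (fun τ => τ ^ (u - 1) * (1 - τ) ^ (v - 1) * (ρ + b * τ) ^ (-p))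
  rw [himg] at hcov
  rw [eulerW, eulerJ, intervalIntegral.integral_of_le zero_le_one,
    intervalIntegral.integral_of_le zero_le_one, integral_Ioc_eq_integral_Ioo,
    integral_Ioc_eq_integral_Ioo, hcov, ← integral_const_mul]
  refine setIntegral_congr_fun measurableSet_Ioo fun σ hσ => ?_
  have hd := hD σ hσ
  have hσ1 : 0 < 1 - σ := by linarith [hσ.2]
  have e1 : 1 - φ σ = (1 - σ) / (1 - w * σ) := by
    simp only [hφ, hlw]
    field_simp
    ring
  have e2 : ρ + b * φ σ = ρ / (1 - w * σ) := by
    have : b * l = ρ * w := by rw [hl, hw]; ring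
    simp only [hφ]
    rw [eq_div_iff hd.ne', add_mul, mul_assoc b, div_mul_cancel₀ _ hd.ne', ← mul_assoc, this]
    ring
  simp only [smul_eq_mul]
  rw [e1, e2, abs_of_pos (by positivity)]
  simp only [hφ]
  rw [Real.div_rpow (by have := hσ.1; positivity) hd.le, Real.div_rpow hσ1.le hd.le,
    Real.div_rpow hρ.le hd.le, Real.mul_rpow hl0.le hσ.1.le]
  have e3 : ρ ^ (u - p) * (ρ + b) ^ (-u) = l * l ^ (u - 1) * ρ ^ (-p) := by
    have : l * l ^ (u - 1) = l ^ u := by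
      rw [mul_comm, ← Real.rpow_add_one hl0.ne']
      simp
    rw [this, hl, Real.div_rpow hρ.le hs.le, Real.rpow_neg hs.le, sub_eq_add_neg,
      Real.rpow_add hρ]
    ring
  have e4 : (1 - w * σ) ^ (p - u - v) = ((1 - w * σ) ^ 2)⁻¹ * ((1 - w * σ) ^ (u - 1))⁻¹ *
      ((1 - w * σ) ^ (v - 1))⁻¹ * ((1 - w * σ) ^ (-p))⁻¹ := by
    rw [← Real.rpow_natCast, ← Real.rpow_neg hd.le, ← Real.rpow_neg hd.le, ← Real.rpow_neg hd.le,
      ← Real.rpow_neg hd.le, ← Real.rpow_add hd, ← Real.rpow_add hd, ← Real.rpow_add hd]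
    congr 1
    push_cast
    ring
  rw [e3, e4]
  ring

/-- Either derivative of the kernel raises `p` by one; the one in `b` also brings down a factor `τ`,
which raises `u`. Staying at first coordinate above `ρ / 2` gives a dominating multiple of the beta
weight. -/
theorem hasFDerivAt_eulerW {u v : ℝ} (hu : 0 < u) (hv : 0 < v) {p : ℝ} (hp : 0 ≤ p)
    {ρ b : ℝ} (hρ : 0 < ρ) (hb : 0 < b) :
    HasFDerivAt (fun z : ℝ × ℝ => eulerW u v p z.1 z.2)
      ((-p * eulerW u v (p + 1) ρ b) • ContinuousLinearMap.fst ℝ ℝ ℝ +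
        (-p * eulerW (u + 1) v (p + 1) ρ b) • ContinuousLinearMap.snd ℝ ℝ ℝ) (ρ, b) := by
  set W : ℝ → ℝ := fun τ => τ ^ (u - 1) * (1 - τ) ^ (v - 1) with hW
  have hWi : IntervalIntegrable W volume 0 1 := (real_beta hu hv).1
  set F : ℝ × ℝ → ℝ → ℝ := fun z τ => W τ * (z.1 + z.2 * τ) ^ (-p) with hF
  set c : ℝ × ℝ → ℝ → ℝ := fun z τ => W τ * (-p * (z.1 + z.2 * τ) ^ (-(p + 1))) with hc
  set F' : ℝ × ℝ → ℝ → (ℝ × ℝ →L[ℝ] ℝ) := fun z τ =>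
    c z τ • ContinuousLinearMap.fst ℝ ℝ ℝ + (c z τ * τ) • ContinuousLinearMap.snd ℝ ℝ ℝ with hF'
  have hWm : Measurable W := by fun_prop
  have hbase : ∀ z : ℝ × ℝ, ρ / 2 < z.1 → 0 < z.2 → ∀ τ ∈ Set.uIoc (0 : ℝ) 1,
      ρ / 2 ≤ z.1 + z.2 * τ := by
    intro z hz1 hz2 τ hτ
    rw [Set.uIoc_of_le zero_le_one] at hτ
    nlinarith [hτ.1]
  have hcb : ∀ z : ℝ × ℝ, ρ / 2 < z.1 → 0 < z.2 → ∀ τ ∈ Set.uIoc (0 : ℝ) 1,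
      |c z τ| ≤ W τ * (p * (ρ / 2) ^ (-(p + 1))) := by
    intro z hz1 hz2 τ hτ
    have h1 := hbase z hz1 hz2 τ hτ
    have h2 : 0 < z.1 + z.2 * τ := by linarith
    have h3 : 0 ≤ W τ := weight_nonneg u v hτ
    have h4 := Real.rpow_nonneg h2.le (-(p + 1))
    rw [show c z τ = -(W τ * (p * (z.1 + z.2 * τ) ^ (-(p + 1)))) by simp only [hc]; ring, abs_neg,
      abs_of_nonneg (mul_nonneg h3 (mul_nonneg hp h4))]
    gcongr W τ * (p * ?_)
    exact Real.rpow_le_rpow_of_nonpos (by linarith) h1 (by linarith)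
  have hci : ∀ z : ℝ × ℝ, ρ / 2 < z.1 → 0 < z.2 → IntervalIntegrable (c z) volume 0 1 := by
    intro z hz1 hz2
    refine (hWi.mul_const (p * (ρ / 2) ^ (-(p + 1)))).mono_fun'
      (by fun_prop : Measurable (c z)).aestronglyMeasurable ?_
    exact (ae_restrict_mem measurableSet_uIoc).mono fun τ hτ => hcb z hz1 hz2 τ hτ
  have hρ2 : ρ / 2 < ρ := by linarith
  have hmain := intervalIntegral.hasFDerivAt_integral_of_dominated_of_fderiv_le (𝕜 := ℝ)
    (μ := volume) (a := 0) (b := 1) (F := F) (F' := F') (x₀ := (ρ, b))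
    (s := {z : ℝ × ℝ | ρ / 2 < z.1 ∧ 0 < z.2})
    (bound := fun τ => W τ * (p * (ρ / 2) ^ (-(p + 1))) + W τ * (p * (ρ / 2) ^ (-(p + 1))))
    (((isOpen_lt continuous_const continuous_fst).inter
      (isOpen_lt continuous_const continuous_snd)).mem_nhds ⟨hρ2, hb⟩)
    (Eventually.of_forall fun z => (by fun_prop : Measurable (F z)).aestronglyMeasurable)
    ?_ ?_ (Eventually.of_forall fun τ hτ z hz => ?_)
    ((hWi.mul_const _).add (hWi.mul_const _)) (Eventually.of_forall fun τ hτ z hz => ?_)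
  · have hcτ : IntervalIntegrable (fun τ => c (ρ, b) τ * τ) volume 0 1 :=
      (hci (ρ, b) hρ2 hb).mul_continuousOn continuousOn_id
    have smul_const' : ∀ {f : ℝ → ℝ}, IntervalIntegrable f volume 0 1 → ∀ T : ℝ × ℝ →L[ℝ] ℝ,
        IntervalIntegrable (fun τ => f τ • T) volume 0 1 := fun hf T =>
      ⟨hf.1.smul_const T, hf.2.smul_const T⟩
    have hval : ∫ τ in (0 : ℝ)..1, F' (ρ, b) τ =
        (-p * eulerW u v (p + 1) ρ b) • ContinuousLinearMap.fst ℝ ℝ ℝ +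
        (-p * eulerW (u + 1) v (p + 1) ρ b) • ContinuousLinearMap.snd ℝ ℝ ℝ := by
      simp only [hF']
      rw [intervalIntegral.integral_add (smul_const' (hci (ρ, b) hρ2 hb) _)
          (smul_const' hcτ _),
        intervalIntegral.integral_smul_const, intervalIntegral.integral_smul_const, eulerW, eulerW,
        ← intervalIntegral.integral_const_mul, ← intervalIntegral.integral_const_mul]
      congr 2
      · refine intervalIntegral.integral_congr fun τ _ => ?_
        simp only [hc, hW]
        ring
      · refine intervalIntegral.integral_congr_ae (Eventually.of_forall fun τ hτ => ?_)
        rw [Set.uIoc_of_le zero_le_one] at hτ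
        simp only [hc, hW]
        rw [show u + 1 - 1 = (u - 1) + 1 by ring, Real.rpow_add_one hτ.1.ne']
        ring
    rw [← hval]
    exact hmain
  · refine (hWi.mul_const ((ρ / 2) ^ (-p))).mono_fun'
      (by fun_prop : Measurable (F (ρ, b))).aestronglyMeasurable ?_
    refine (ae_restrict_mem measurableSet_uIoc).mono fun τ hτ => ?_
    have h1 := hbase (ρ, b) hρ2 hb τ hτ
    have h3 : 0 ≤ W τ := weight_nonneg u v hτ
    have h4 : 0 ≤ (ρ + b * τ) ^ (-p) := Real.rpow_nonneg (by dsimp at h1; linarith) _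
    simp only [hF]
    rw [Real.norm_of_nonneg (mul_nonneg h3 h4)]
    gcongr W τ * ?_
    exact Real.rpow_le_rpow_of_nonpos (by linarith) h1 (by linarith)
  · have hcm : Measurable (c (ρ, b)) := by fun_prop
    exact ((hcm.smul_const _).add ((hcm.mul measurable_id).smul_const _)).aestronglyMeasurable
  · have h1 := hcb z hz.1 hz.2 τ hτ
    rw [Set.uIoc_of_le zero_le_one] at hτ
    refine (norm_add_le _ _).trans (add_le_add ?_ ?_)
    · rw [norm_smul, Real.norm_eq_abs]
      exact (mul_le_of_le_one_right (abs_nonneg _) (ContinuousLinearMap.norm_fst_le ℝ ℝ ℝ)).trans h1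
    · rw [norm_smul, Real.norm_eq_abs]
      refine (mul_le_of_le_one_right (abs_nonneg _)
        (ContinuousLinearMap.norm_snd_le ℝ ℝ ℝ)).trans (le_trans ?_ h1)
      rw [abs_mul]
      exact mul_le_of_le_one_right (abs_nonneg _) (abs_le.2 ⟨by linarith [hτ.1], hτ.2⟩)
  · have h1 := hbase z hz.1 hz.2 τ hτ
    have h2 : HasFDerivAt (fun z : ℝ × ℝ => z.1 + z.2 * τ)
        (ContinuousLinearMap.fst ℝ ℝ ℝ + τ • ContinuousLinearMap.snd ℝ ℝ ℝ) z :=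
      (ContinuousLinearMap.fst ℝ ℝ ℝ).hasFDerivAt.add
        ((ContinuousLinearMap.snd ℝ ℝ ℝ).hasFDerivAt.mul_const τ)
    have h3 := (h2.rpow_const (p := -p) (Or.inl (by linarith))).const_mul (W τ)
    refine h3.congr_fderiv ?_
    simp only [hF', hc, smul_add, smul_smul]
    rw [show -(p + 1) = -p - 1 by ring]
    congr 2
    ring

end EulerIntegral

/-! ### The kernel `q1` and its gradient -/

section Kernel

variable {m : ℕ} [NeZero m]

/-- Euler's integral with `ρ = r²` and `ρ + b = r₁²`. -/
noncomputable def kerW (u v p : ℝ) (ξ x : EuclideanSpace ℝ (Fin m)) : ℝ :=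
  eulerW u v p (‖x - ξ‖ ^ 2) (4 * ξ 0 * x 0)

/-- The right side is `r₁²`, the squared distance from `x` to the mirror image of `ξ`. It stays away
from 0, so powers of `r₁` never contribute a singularity. -/
theorem sq_le_reflected {ξ x : EuclideanSpace ℝ (Fin m)} (hξ : 0 ≤ ξ 0) (hx : 0 ≤ x 0) :
    x 0 ^ 2 ≤ ‖x - ξ‖ ^ 2 + 4 * ξ 0 * x 0 := by
  have h : |(x - ξ) 0| ≤ ‖x - ξ‖ := PiLp.norm_apply_le (x - ξ) 0
  have h2 : (x - ξ) 0 ^ 2 ≤ ‖x - ξ‖ ^ 2 := by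
    rw [← sq_abs]
    gcongr
  simp only [PiLp.sub_apply] at h2
  nlinarith [mul_nonneg hξ hx, sq_nonneg (ξ 0)]

theorem kerW_eq (u v p : ℝ) {ξ x : EuclideanSpace ℝ (Fin m)} (hξ : 0 ≤ ξ 0) (hx : 0 ≤ x 0)
    (hne : ξ ≠ x) : kerW u v p ξ x = (‖x - ξ‖ ^ 2) ^ (u - p) *
      (‖x - ξ‖ ^ 2 + 4 * ξ 0 * x 0) ^ (-u) *
      eulerJ u v (p - u - v) (4 * ξ 0 * x 0 / (‖x - ξ‖ ^ 2 + 4 * ξ 0 * x 0)) :=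
  eulerW_eq_eulerJ u v p (pow_pos (norm_pos_iff.2 (sub_ne_zero.2 hne.symm)) 2) (by positivity)

theorem argument_mem_Icc {ξ x : EuclideanSpace ℝ (Fin m)} (hξ : 0 ≤ ξ 0) (hx : 0 < x 0) :
    4 * ξ 0 * x 0 / (‖x - ξ‖ ^ 2 + 4 * ξ 0 * x 0) ∈ Set.Icc (0 : ℝ) 1 := by
  have h := sq_le_reflected hξ hx.le
  have h0 : 0 < x 0 ^ 2 := by positivity
  exact ⟨by positivity, (div_le_one (by linarith)).2 (by linarith [sq_nonneg ‖x - ξ‖])⟩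

theorem continuousOn_kerW {u v p : ℝ} (hu : 0 < u) (hv : 0 < v) (hp : 0 ≤ p - u - v) :
    ContinuousOn (fun z : EuclideanSpace ℝ (Fin m) × EuclideanSpace ℝ (Fin m) =>
      kerW u v p z.1 z.2) {z | 0 ≤ z.1 0 ∧ 0 < z.2 0 ∧ z.1 ≠ z.2} := by
  have hR : ∀ z ∈ {z : EuclideanSpace ℝ (Fin m) × EuclideanSpace ℝ (Fin m) |
      0 ≤ z.1 0 ∧ 0 < z.2 0 ∧ z.1 ≠ z.2}, ‖z.2 - z.1‖ ^ 2 + 4 * z.1 0 * z.2 0 ≠ 0 := by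
    intro z hz
    have h := sq_le_reflected hz.1 hz.2.1.le
    have h0 : 0 < z.2 0 ^ 2 := pow_pos hz.2.1 2
    linarith
  have hcR : Continuous fun z : EuclideanSpace ℝ (Fin m) × EuclideanSpace ℝ (Fin m) =>
      ‖z.2 - z.1‖ ^ 2 + 4 * z.1 0 * z.2 0 := by fun_prop
  have hcb : Continuous fun z : EuclideanSpace ℝ (Fin m) × EuclideanSpace ℝ (Fin m) =>
      4 * z.1 0 * z.2 0 := by fun_prop
  refine ContinuousOn.congr ?_ fun z hz => kerW_eq u v p hz.1 hz.2.1.le hz.2.2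
  refine ((ContinuousOn.rpow_const (by fun_prop) fun z hz => Or.inl ?_).mul
    (hcR.continuousOn.rpow_const fun z hz => Or.inl (hR z hz))).mul
    ((continuousOn_eulerJ hu hv hp).comp (hcb.continuousOn.div hcR.continuousOn hR)
      fun z hz => argument_mem_Icc hz.1 hz.2.1)
  exact pow_ne_zero 2 (norm_ne_zero_iff.2 (sub_ne_zero.2 hz.2.2.symm))

/-- `eulerJ` is bounded on the compact interval and `r₁ ≥ c`, so only the power of `r` remains. -/
theorem exists_kerW_bound {u v p : ℝ} (hu : 0 < u) (hv : 0 < v) (hp : 0 ≤ p - u - v) {c : ℝ}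
    (hc : 0 < c) : ∃ M : ℝ, 0 ≤ M ∧ ∀ ξ x : EuclideanSpace ℝ (Fin m), 0 ≤ ξ 0 → c ≤ x 0 → ξ ≠ x →
      |kerW u v p ξ x| ≤ M * (‖x - ξ‖ ^ 2) ^ (u - p) := by
  obtain ⟨N, hN⟩ := isCompact_Icc.exists_bound_of_continuousOn (continuousOn_eulerJ hu hv hp)
  have hN0 : 0 ≤ N := (norm_nonneg _).trans (hN 0 (by simp))
  refine ⟨(c ^ 2) ^ (-u) * N, by positivity, fun ξ x hξ hx hne => ?_⟩
  have hx0 : 0 < x 0 := hc.trans_le hx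
  have hR : c ^ 2 ≤ ‖x - ξ‖ ^ 2 + 4 * ξ 0 * x 0 :=
    le_trans (by gcongr) (sq_le_reflected hξ hx0.le)
  have hR0 : 0 < ‖x - ξ‖ ^ 2 + 4 * ξ 0 * x 0 := lt_of_lt_of_le (by positivity) hR
  have hJ := hN _ (argument_mem_Icc (x := x) hξ hx0)
  rw [Real.norm_eq_abs] at hJ
  rw [kerW_eq u v p hξ hx0.le hne, abs_mul, abs_mul,
    abs_of_nonneg (by positivity : 0 ≤ (‖x - ξ‖ ^ 2) ^ (u - p)),
    abs_of_nonneg (Real.rpow_nonneg hR0.le _)]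
  have h1 := Real.rpow_le_rpow_of_nonpos (by positivity) hR (by linarith : -u ≤ 0)
  calc _ ≤ (‖x - ξ‖ ^ 2) ^ (u - p) * (c ^ 2) ^ (-u) * N := by gcongr
    _ = _ := by ring

theorem hasFDerivAt_kerW {u v p : ℝ} (hu : 0 < u) (hv : 0 < v) (hp : 0 ≤ p)
    {ξ x : EuclideanSpace ℝ (Fin m)} (hξ : 0 < ξ 0) (hx : 0 < x 0) (hne : ξ ≠ x) :
    HasFDerivAt (fun x => kerW u v p ξ x)
      ((-(2 * p)) • (kerW u v (p + 1) ξ x • innerSL ℝ (x - ξ) +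
        (2 * ξ 0 * kerW (u + 1) v (p + 1) ξ x) • EuclideanSpace.proj (𝕜 := ℝ) (0 : Fin m))) x := by
  have hρ : 0 < ‖x - ξ‖ ^ 2 := pow_pos (norm_pos_iff.2 (sub_ne_zero.2 hne.symm)) 2
  have h1 : HasFDerivAt (fun x : EuclideanSpace ℝ (Fin m) => ‖x - ξ‖ ^ 2)
      (2 • innerSL ℝ (x - ξ)) x := by
    simpa using ((hasFDerivAt_id x).sub_const ξ).norm_sq
  have h2 : HasFDerivAt (fun x : EuclideanSpace ℝ (Fin m) => 4 * ξ 0 * x 0)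
      ((4 * ξ 0) • EuclideanSpace.proj (𝕜 := ℝ) (0 : Fin m)) x :=
    (EuclideanSpace.proj (𝕜 := ℝ) (0 : Fin m)).hasFDerivAt.const_mul (4 * ξ 0)
  have h3 := HasFDerivAt.comp x (hasFDerivAt_eulerW hu hv hp hρ
    (by positivity : 0 < 4 * ξ 0 * x 0)) (h1.prodMk h2)
  refine h3.congr_fderiv ?_
  ext y
  simp [kerW]
  ring

/-- The constant in Euler's integral for `q₁`. -/
noncomputable def qConst (m : ℕ) (α : ℝ) : ℝ :=
  k1 m α * (Real.Gamma (2 * α) / (Real.Gamma α * Real.Gamma (2 * α - α)))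

/-- Since `r² (1 - r₁²/r²) = -4 ξ₁ x₁`, the prefactor `(r²)^(-a)` can be absorbed into the
integrand, which becomes homogeneous in `r²` and `4 ξ₁ x₁`. -/
theorem q1_eq_kerW {α : ℝ} {ξ x : EuclideanSpace ℝ (Fin m)} (hξ : 0 ≤ ξ 0) (hx : 0 ≤ x 0)
    (hne : ξ ≠ x) :
    q1 α ξ x = qConst m α * kerW α α (α + ((m : ℝ) - 2) / 2) ξ x := by
  have hr : rSq ξ x = ‖x - ξ‖ ^ 2 := by
    rw [norm_sub_rev, EuclideanSpace.real_norm_sq_eq]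
    rfl
  have hρ : 0 < rSq ξ x := by
    rw [hr]
    exact pow_pos (norm_pos_iff.2 (sub_ne_zero.2 hne.symm)) 2
  have hr1 : r1Sq ξ x = rSq ξ x + 4 * ξ 0 * x 0 := by
    rw [r1Sq, rSq, ← Finset.add_sum_erase _ _ (Finset.mem_univ (0 : Fin m))]
    ring
  set a := α + ((m : ℝ) - 2) / 2 with ha
  rw [q1, gaussF, kerW, eulerW, qConst, ← hr, show -α - ((m : ℝ) - 2) / 2 = -a by rw [ha]; ring,
    ← ha]
  have hInt : (rSq ξ x) ^ (-a) * ∫ τ in (0 : ℝ)..1, τ ^ (α - 1) * (1 - τ) ^ (2 * α - α - 1) *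
      (1 - (1 - r1Sq ξ x / rSq ξ x) * τ) ^ (-a) =
      ∫ τ in (0 : ℝ)..1, τ ^ (α - 1) * (1 - τ) ^ (α - 1) *
        (rSq ξ x + 4 * ξ 0 * x 0 * τ) ^ (-a) := by
    rw [← intervalIntegral.integral_const_mul]
    refine intervalIntegral.integral_congr_ae (Eventually.of_forall fun τ hτ => ?_)
    rw [Set.uIoc_of_le zero_le_one] at hτ
    have h1 : rSq ξ x + 4 * ξ 0 * x 0 * τ =
        rSq ξ x * (1 - (1 - r1Sq ξ x / rSq ξ x) * τ) := by
      rw [hr1]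
      field_simp
      ring
    have h2 : 0 ≤ 1 - (1 - r1Sq ξ x / rSq ξ x) * τ := by
      rw [← mul_nonneg_iff_of_pos_left hρ, ← h1]
      have := hτ.1
      positivity
    rw [h1, Real.mul_rpow hρ.le h2, show 2 * α - α - 1 = α - 1 by ring]
    ring
  rw [← hInt]
  ring

/-- The derivative of `q₁(ξ, ·)` at `x`. -/
noncomputable def qDeriv (α : ℝ) (ξ x : EuclideanSpace ℝ (Fin m)) :
    EuclideanSpace ℝ (Fin m) →L[ℝ] ℝ :=
  (-(2 * (α + ((m : ℝ) - 2) / 2) * qConst m α)) •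
    (kerW α α (α + (m : ℝ) / 2) ξ x • innerSL ℝ (x - ξ) +
      (2 * ξ 0 * kerW (α + 1) α (α + (m : ℝ) / 2) ξ x) • EuclideanSpace.proj (𝕜 := ℝ) (0 : Fin m))

/-- For `x` away from the hyperplane the term along `x - ξ` is of order `r^(1-m)` and the other one
of order `r^(2-m)`. Only the former can produce a jump across an `(m-1)`-dimensional surface. -/
theorem hasFDerivAt_q1 (hm : 2 < m) {α : ℝ} (hα : 0 < α) {ξ x : EuclideanSpace ℝ (Fin m)}
    (hξ : 0 < ξ 0) (hx : 0 < x 0) (hne : ξ ≠ x) :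
    HasFDerivAt (fun x => q1 α ξ x) (qDeriv α ξ x) x := by
  have hm' : (2 : ℝ) < m := by exact_mod_cast hm
  have h1 := (hasFDerivAt_kerW hα hα (p := α + ((m : ℝ) - 2) / 2) (by linarith)
    hξ hx hne).const_mul (qConst m α)
  have h2 : HasFDerivAt (fun x => qConst m α * kerW α α (α + ((m : ℝ) - 2) / 2) ξ x)
      (qDeriv α ξ x) x := by
    refine h1.congr_fderiv ?_
    rw [qDeriv, smul_smul, show α + ((m : ℝ) - 2) / 2 + 1 = α + (m : ℝ) / 2 by ring]
    congr 1
    ring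
  refine h2.congr_of_eventuallyEq ?_
  filter_upwards [isOpen_halfSpace.mem_nhds hx, isOpen_ne.mem_nhds hne.symm] with y hy hy'
  exact q1_eq_kerW hξ.le (le_of_lt hy) (Ne.symm hy')

theorem qDeriv_apply (α : ℝ) (ξ x v : EuclideanSpace ℝ (Fin m)) :
    qDeriv α ξ x v = -(2 * (α + ((m : ℝ) - 2) / 2) * qConst m α) *
      (kerW α α (α + (m : ℝ) / 2) ξ x * ⟪x - ξ, v⟫ +
        2 * ξ 0 * kerW (α + 1) α (α + (m : ℝ) / 2) ξ x * v 0) := by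
  simp [qDeriv, inner_sub_left]
  ring

end Kernel

end SimpleLayer

/-- Integrals against an approximate identity, with integrands depending on the parameter. -/
theorem tendsto_integral_mul_of_approx_identity {X : Type*} [PseudoMetricSpace X]
    [MeasurableSpace X] [BorelSpace X] {μ : Measure X} {t : X} {l : Filter ℝ} {P K : ℝ → X → ℝ}
    {c k M : ℝ}
    (hP0 : ∀ᶠ h in l, ∀ ξ, 0 ≤ P h ξ) (hPi : ∀ᶠ h in l, Integrable (P h) μ)
    (hPlim : Tendsto (fun h => ∫ ξ, P h ξ ∂μ) l (𝓝 c))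
    (hPout : ∀ δ > 0, Tendsto (fun h => ∫ ξ in (Metric.ball t δ)ᶜ, P h ξ ∂μ) l (𝓝 0))
    (hKm : ∀ᶠ h in l, AEStronglyMeasurable (K h) μ)
    (hKb : ∀ᶠ h in l, ∀ᵐ ξ ∂μ, |K h ξ| ≤ M)
    (hK : ∀ ε > 0, ∃ δ > 0, ∀ᶠ h in l, ∀ᵐ ξ ∂μ, dist ξ t < δ → |K h ξ - k| ≤ ε) :
    Tendsto (fun h => ∫ ξ, P h ξ * K h ξ ∂μ) l (𝓝 (c * k)) := by
  have hdiff : Tendsto (fun h => ∫ ξ, P h ξ * (K h ξ - k) ∂μ) l (𝓝 0) := by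
    refine Metric.tendsto_nhds.2 fun ε hε => ?_
    -- Inside the ball `|K - k| ≤ ε₁` against total mass close to `c`, and `ε₁ c ≤ ε / 2`; outside,
    -- `K - k` is bounded and the mass vanishes. The `+ 1` covers `c = 0`.
    set ε₁ := ε / (2 * (|c| + 1)) with hε₁
    have hc1 : 0 < |c| + 1 := by positivity
    have hε₁pos : 0 < ε₁ := by positivity
    obtain ⟨δ, hδ, hKδ⟩ := hK ε₁ hε₁pos
    have hlim : Tendsto (fun h => ε₁ * ∫ ξ, P h ξ ∂μ +
        (|M| + |k|) * ∫ ξ in (Metric.ball t δ)ᶜ, P h ξ ∂μ) l (𝓝 (ε₁ * c + (|M| + |k|) * 0)) :=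
      (hPlim.const_mul _).add ((hPout δ hδ).const_mul _)
    have hlt : ε₁ * c + (|M| + |k|) * 0 < ε := by
      have h1 : ε₁ * c ≤ ε₁ * |c| := by gcongr; exact le_abs_self c
      have h2 : ε₁ * (|c| + 1) = ε / 2 := by rw [hε₁]; field_simp
      nlinarith
    filter_upwards [hP0, hPi, hKb, hKδ, hlim.eventually (gt_mem_nhds hlt)]
      with h h0 hi hb hd hl
    rw [dist_zero_right]
    refine lt_of_le_of_lt ?_ hl
    have hind : Integrable ((Metric.ball t δ)ᶜ.indicator (P h)) μ :=
      hi.indicator measurableSet_ball.compl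
    rw [← integral_indicator measurableSet_ball.compl, ← integral_const_mul,
      ← integral_const_mul, ← integral_add (hi.const_mul _) (hind.const_mul _)]
    refine norm_integral_le_of_norm_le ((hi.const_mul _).add (hind.const_mul _)) ?_
    filter_upwards [hb, hd] with ξ hb hd
    rw [Real.norm_eq_abs, abs_mul, abs_of_nonneg (h0 ξ)]
    by_cases hξ : dist ξ t < δ
    · rw [Set.indicator_of_notMem (by simpa using hξ), mul_zero, add_zero, mul_comm]
      exact mul_le_mul_of_nonneg_right (hd hξ) (h0 ξ)
    · rw [Set.indicator_of_mem (by simpa using hξ)]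
      have h1 : |K h ξ - k| ≤ |M| + |k| :=
        (abs_sub _ _).trans (add_le_add (hb.trans (le_abs_self M)) le_rfl)
      nlinarith [h0 ξ, mul_le_mul_of_nonneg_right h1 (h0 ξ), mul_nonneg hε₁pos.le (h0 ξ)]
  have hsum := hdiff.add (hPlim.mul_const k)
  rw [zero_add] at hsum
  refine hsum.congr' ?_
  filter_upwards [hPi, hKm, hKb] with h hi hm hb
  have hKi : Integrable (fun ξ => P h ξ * K h ξ) μ := hi.mul_bdd hm hb
  rw [← integral_mul_const, ← integral_add]
  · refine integral_congr_ae (Eventually.of_forall fun ξ => ?_)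
    ring
  · refine (hKi.sub (hi.mul_const k)).congr (Eventually.of_forall fun ξ => ?_)
    simp only [Pi.sub_apply]
    ring
  · exact hi.mul_const k

/-! ### The potential off `Γ` and distances along a normal -/

namespace SimpleLayer

variable {m : ℕ} [NeZero m] {Ω : Set (EuclideanSpace ℝ (Fin m))}
  {n : EuclideanSpace ℝ (Fin m) → EuclideanSpace ℝ (Fin m)}

theorem continuousOn_kerW_left {u v p : ℝ} (hu : 0 < u) (hv : 0 < v) (hp : 0 ≤ p - u - v)
    {x : EuclideanSpace ℝ (Fin m)} (hx : 0 < x 0) :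
    ContinuousOn (fun ξ => kerW u v p ξ x) {ξ | 0 ≤ ξ 0 ∧ ξ ≠ x} :=
  (continuousOn_kerW hu hv hp).comp (f := fun ξ => (ξ, x)) (by fun_prop)
    fun ξ hξ => ⟨hξ.1, hx, hξ.2⟩

theorem continuousAt_kerW_right {u v p : ℝ} (hu : 0 < u) (hv : 0 < v) (hp : 0 ≤ p - u - v)
    {ξ x : EuclideanSpace ℝ (Fin m)} (hξ : 0 ≤ ξ 0) (hx : 0 < x 0) (hne : ξ ≠ x) :
    ContinuousAt (fun x => kerW u v p ξ x) x := by
  have h : ContinuousOn (fun x => kerW u v p ξ x) (halfSpace m ∩ {y | y ≠ ξ}) :=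
    (continuousOn_kerW hu hv hp).comp (f := fun x => (ξ, x)) (by fun_prop)
      fun y hy => ⟨hξ, hy.1, Ne.symm hy.2⟩
  exact h.continuousAt ((isOpen_halfSpace.inter isOpen_ne).mem_nhds ⟨hx, hne.symm⟩)

theorem continuousOn_qDeriv (hm : 2 < m) {α : ℝ} (hα₀ : 0 < 2 * α) (hα₁ : 2 * α < 1)
    {x : EuclideanSpace ℝ (Fin m)} (hx : 0 < x 0) :
    ContinuousOn (fun ξ => qDeriv α ξ x) {ξ | 0 ≤ ξ 0 ∧ ξ ≠ x} := by
  have hm' : (3 : ℝ) ≤ m := by exact_mod_cast hm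
  have hA := continuousOn_kerW_left (u := α) (v := α) (p := α + (m : ℝ) / 2) (by linarith)
    (by linarith) (by linarith) hx
  -- Here `p - u - v = m/2 - α - 1`, which is nonnegative because `m ≥ 3` and `α < 1/2`.
  have hB := continuousOn_kerW_left (u := α + 1) (v := α) (p := α + (m : ℝ) / 2) (by linarith)
    (by linarith) (by linarith) hx
  have hi : Continuous fun ξ : EuclideanSpace ℝ (Fin m) => innerSL ℝ (x - ξ) := by fun_prop
  have h0 : Continuous fun ξ : EuclideanSpace ℝ (Fin m) => 2 * ξ 0 := by fun_prop
  exact ((hA.smul hi.continuousOn).add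
    ((h0.continuousOn.mul hB).smul continuousOn_const)).const_smul
    (-(2 * (α + ((m : ℝ) - 2) / 2) * qConst m α))

theorem norm_qDeriv_le (α : ℝ) (ξ x : EuclideanSpace ℝ (Fin m)) :
    ‖qDeriv α ξ x‖ ≤ |2 * (α + ((m : ℝ) - 2) / 2) * qConst m α| *
      (|kerW α α (α + (m : ℝ) / 2) ξ x| * ‖x - ξ‖ +
        2 * |ξ 0| * |kerW (α + 1) α (α + (m : ℝ) / 2) ξ x|) := by
  have hproj : ‖(EuclideanSpace.proj (0 : Fin m) : EuclideanSpace ℝ (Fin m) →L[ℝ] ℝ)‖ ≤ 1 :=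
    ContinuousLinearMap.opNorm_le_bound _ zero_le_one fun y => by
      simpa using PiLp.norm_apply_le y 0
  rw [qDeriv, norm_smul, norm_neg, Real.norm_eq_abs]
  refine mul_le_mul_of_nonneg_left ((norm_add_le _ _).trans (add_le_add ?_ ?_)) (abs_nonneg _)
  · rw [norm_smul, innerSL_apply_norm, Real.norm_eq_abs]
  · rw [norm_smul, Real.norm_eq_abs, abs_mul, abs_mul, abs_two]
    exact mul_le_of_le_one_right (by positivity) hproj

theorem ae_mem_surf (Ω : Set (EuclideanSpace ℝ (Fin m))) :
    ∀ᵐ ξ ∂(surfMeasure Ω), ξ ∈ surf Ω := ae_restrict_mem measurableSet_surf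

/-- Points are null because `m - 1 > 0`. This allows the pole to be discarded, where the kernel
formulas fail. -/
theorem ae_ne_surfMeasure (hm : 2 < m) (Ω : Set (EuclideanSpace ℝ (Fin m)))
    (t : EuclideanSpace ℝ (Fin m)) : ∀ᵐ ξ ∂(surfMeasure Ω), ξ ≠ t := by
  have hd : (0 : ℝ) < ((m - 1 : ℕ) : ℝ) := by
    have : 0 < m - 1 := by omega
    exact_mod_cast this
  have h0 : (μHE[m - 1] : Measure (EuclideanSpace ℝ (Fin m))) {t} = 0 := by
    have := Measure.nullSingletonClass_hausdorff (EuclideanSpace ℝ (Fin m)) hd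
    rw [Measure.euclideanHausdorffMeasure_def, Measure.smul_apply, measure_singleton, smul_zero]
  rw [ae_iff]
  refine le_antisymm (le_trans (Measure.restrict_apply_le _ _) ?_) zero_le
  simpa using h0.le

namespace IsLyapunovDomain

theorem exists_density_bound (hΩ : IsLyapunovDomain Ω n) {ρ : EuclideanSpace ℝ (Fin m) → ℝ}
    (hρ : ContinuousOn ρ (closure (surf Ω))) : ∃ M, 0 ≤ M ∧ ∀ ξ ∈ surf Ω, |ρ ξ| ≤ M := by
  obtain ⟨M, hM⟩ := (Metric.isCompact_of_isClosed_isBounded isClosed_closure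
    hΩ.isBounded_surf.closure).exists_bound_of_continuousOn hρ
  exact ⟨|M|, abs_nonneg M, fun ξ hξ => (hM ξ (subset_closure hξ)).trans (le_abs_self M)⟩

theorem exists_first_coord_bound (hΩ : IsLyapunovDomain Ω n)
    : ∃ M, 0 ≤ M ∧ ∀ ξ ∈ surf Ω, |ξ 0| ≤ M := by
  obtain ⟨M, hM⟩ := hΩ.isBounded_surf.exists_norm_le
  exact ⟨|M|, abs_nonneg M, fun ξ hξ =>
    (PiLp.norm_apply_le ξ 0).trans ((hM ξ hξ).trans (le_abs_self M))⟩

/-- Off `Γ` the simple-layer potential may be differentiated under the integral sign. -/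
theorem hasFDerivAt_simpleLayer (hΩ : IsLyapunovDomain Ω n)
    (hm : 2 < m) {α : ℝ} (hα₀ : 0 < 2 * α) (hα₁ : 2 * α < 1)
    {ρ : EuclideanSpace ℝ (Fin m) → ℝ} (hρ : ContinuousOn ρ (closure (surf Ω)))
    {x : EuclideanSpace ℝ (Fin m)} (hx : x ∈ halfSpace m \ surf Ω) :
    Integrable (fun ξ => ρ ξ * q1 α ξ x) (surfMeasure Ω) ∧
    Integrable (fun ξ => ρ ξ • qDeriv α ξ x) (surfMeasure Ω) ∧
    HasFDerivAt (simpleLayer α Ω ρ) (∫ ξ, ρ ξ • qDeriv α ξ x ∂(surfMeasure Ω)) x := by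
  have hfin := hΩ.isFiniteMeasure_surfMeasure
  have hm' : (3 : ℝ) ≤ m := by exact_mod_cast hm
  have hα : 0 < α := by linarith
  obtain ⟨N, hN0, hN⟩ := hΩ.exists_density_bound hρ
  obtain ⟨X, hX0, hX⟩ := hΩ.exists_first_coord_bound
  have hxf : x ∉ frontier Ω := fun h => hx.2 ⟨h, hx.1⟩
  have hx0 : 0 < x 0 := hx.1
  have hop : IsOpen ({y : EuclideanSpace ℝ (Fin m) | x 0 / 2 < y 0} ∩ (frontier Ω)ᶜ) :=
    (isOpen_lt continuous_const (by fun_prop)).inter isClosed_frontier.isOpen_compl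
  -- On the ball of half this radius the distance to `Γ` is at least `ε / 2` and the first
  -- coordinate at least `x 0 / 2`. All kernels are then bounded uniformly, and a constant dominates
  -- because `Γ` has finite measure.
  obtain ⟨ε, hε, hball⟩ := Metric.isOpen_iff.1 hop x ⟨by simpa using hx0, hxf⟩
  have hfar : ∀ y ∈ Metric.ball x (ε / 2), ∀ ξ ∈ surf Ω, ε / 2 ≤ ‖y - ξ‖ := by
    intro y hy ξ hξ
    by_contra! h
    refine (hball (?_ : ξ ∈ Metric.ball x ε)).2 hξ.1
    have h1 := dist_triangle ξ y x
    rw [dist_comm ξ y, dist_eq_norm y ξ] at h1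
    exact Metric.mem_ball.2 (by linarith [Metric.mem_ball.1 hy])
  have hy0 : ∀ y ∈ Metric.ball x (ε / 2), x 0 / 2 ≤ y 0 := fun y hy =>
    le_of_lt (hball (Metric.ball_subset_ball (by linarith) hy)).1
  have hyne : ∀ y ∈ Metric.ball x (ε / 2), ∀ ξ ∈ surf Ω, ξ ≠ y := by
    rintro y hy ξ hξ rfl
    have := hfar ξ hy ξ hξ
    rw [sub_self, norm_zero] at this
    linarith
  have hxball : x ∈ Metric.ball x (ε / 2) := Metric.mem_ball_self (by linarith)
  have hρm : ContinuousOn ρ (surf Ω) := hρ.mono subset_closure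
  have hqc : ∀ y ∈ Metric.ball x (ε / 2), ContinuousOn (fun ξ => q1 α ξ y) (surf Ω) := by
    intro y hy
    refine ContinuousOn.congr (f := fun ξ => qConst m α * kerW α α (α + ((m : ℝ) - 2) / 2) ξ y)
      ?_ fun ξ hξ => q1_eq_kerW (le_of_lt hξ.2) (by linarith [hy0 y hy]) (hyne y hy ξ hξ)
    refine continuousOn_const.mul ((continuousOn_kerW_left hα hα (by linarith)
      (by linarith [hy0 y hy])).mono fun ξ hξ => ⟨le_of_lt hξ.2, hyne y hy ξ hξ⟩)
  have hqm : ∀ y ∈ Metric.ball x (ε / 2),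
      AEStronglyMeasurable (fun ξ => ρ ξ * q1 α ξ y) (surfMeasure Ω) := fun y hy =>
    (hρm.mul (hqc y hy)).aestronglyMeasurable measurableSet_surf
  obtain ⟨M₀, hM₀, hb₀⟩ := exists_kerW_bound (m := m) (u := α) (v := α)
    (p := α + ((m : ℝ) - 2) / 2) hα hα (by linarith) (half_pos hx0)
  obtain ⟨M₁, hM₁, hb₁⟩ := exists_kerW_bound (m := m) (u := α) (v := α)
    (p := α + (m : ℝ) / 2) hα hα (by linarith) (half_pos hx0)
  obtain ⟨M₂, hM₂, hb₂⟩ := exists_kerW_bound (m := m) (u := α + 1) (v := α)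
    (p := α + (m : ℝ) / 2) (by linarith) hα (by linarith) (half_pos hx0)
  have hpow : ∀ y ∈ Metric.ball x (ε / 2), ∀ ξ ∈ surf Ω, ∀ e ≤ (0 : ℝ),
      (‖y - ξ‖ ^ 2) ^ e ≤ ((ε / 2) ^ 2) ^ e := fun y hy ξ hξ e he =>
    Real.rpow_le_rpow_of_nonpos (by positivity) (by have := hfar y hy ξ hξ; gcongr) he
  have hInt : Integrable (fun ξ => ρ ξ * q1 α ξ x) (surfMeasure Ω) := by
    refine Integrable.of_bound (hqm x hxball) (N * (|qConst m α| * (M₀ * ((ε / 2) ^ 2) ^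
      (α - (α + ((m : ℝ) - 2) / 2))))) ((ae_mem_surf Ω).mono fun ξ hξ => ?_)
    have hne := hyne x hxball ξ hξ
    rw [norm_mul, q1_eq_kerW (le_of_lt hξ.2) hx0.le hne, norm_mul, Real.norm_eq_abs,
      Real.norm_eq_abs, Real.norm_eq_abs]
    have h1 := hb₀ ξ x (le_of_lt hξ.2) (hy0 x hxball) hne
    have h2 := hpow x hxball ξ hξ (α - (α + ((m : ℝ) - 2) / 2)) (by linarith)
    have h3 := hN ξ hξ
    have h4 := h1.trans (mul_le_mul_of_nonneg_left h2 hM₀)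
    gcongr
  have hdm : AEStronglyMeasurable (fun ξ => ρ ξ • qDeriv α ξ x) (surfMeasure Ω) :=
    (hρm.smul ((continuousOn_qDeriv hm hα₀ hα₁ hx0).mono fun ξ hξ =>
      ⟨le_of_lt hξ.2, hyne x hxball ξ hξ⟩)).aestronglyMeasurable measurableSet_surf
  -- The exponent `1/2 - m/2` arises by absorbing the factor `‖y - ξ‖` into `(‖y - ξ‖²)^(-m/2)`.
  set B : ℝ := N * (|2 * (α + ((m : ℝ) - 2) / 2) * qConst m α| *
    (M₁ * ((ε / 2) ^ 2) ^ (1 / 2 - (m : ℝ) / 2) +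
      2 * X * (M₂ * ((ε / 2) ^ 2) ^ (α + 1 - (α + (m : ℝ) / 2))))) with hB
  have hbound : ∀ ξ ∈ surf Ω, ∀ y ∈ Metric.ball x (ε / 2), ‖ρ ξ • qDeriv α ξ y‖ ≤ B := by
    intro ξ hξ y hy
    have hne := hyne y hy ξ hξ
    have hpos : 0 < ‖y - ξ‖ := lt_of_lt_of_le (by linarith) (hfar y hy ξ hξ)
    have h1 := hb₁ ξ y (le_of_lt hξ.2) (hy0 y hy) hne
    have h2 := hb₂ ξ y (le_of_lt hξ.2) (hy0 y hy) hne
    have h3 := hN ξ hξ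
    have h4 : |kerW α α (α + (m : ℝ) / 2) ξ y| * ‖y - ξ‖ ≤
        M₁ * ((ε / 2) ^ 2) ^ (1 / 2 - (m : ℝ) / 2) := by
      calc _ ≤ M₁ * (‖y - ξ‖ ^ 2) ^ (α - (α + (m : ℝ) / 2)) * ‖y - ξ‖ := by gcongr
        _ = M₁ * (‖y - ξ‖ ^ 2) ^ (1 / 2 - (m : ℝ) / 2) := by
          rw [mul_assoc]
          congr 1
          nth_rewrite 2 [← Real.sqrt_sq hpos.le]
          rw [Real.sqrt_eq_rpow, ← Real.rpow_add (by positivity)]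
          congr 1
          ring
        _ ≤ _ := mul_le_mul_of_nonneg_left (hpow y hy ξ hξ _ (by linarith)) hM₁
    have h5 := h2.trans (mul_le_mul_of_nonneg_left (hpow y hy ξ hξ _ (by linarith)) hM₂)
    have h6 := hX ξ hξ
    rw [norm_smul, Real.norm_eq_abs]
    refine mul_le_mul h3 ((norm_qDeriv_le α ξ y).trans ?_) (norm_nonneg _) hN0
    gcongr
  refine ⟨hInt, ?_, ?_⟩
  · exact Integrable.of_bound hdm B ((ae_mem_surf Ω).mono fun ξ hξ => hbound ξ hξ x hxball)
  · refine hasFDerivAt_integral_of_dominated_of_fderiv_le (𝕜 := ℝ) (bound := fun _ => B)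
      (F' := fun x ξ => ρ ξ • qDeriv α ξ x)
      (Metric.ball_mem_nhds x (by linarith : 0 < ε / 2)) ?_ hInt hdm ?_ (integrable_const B) ?_
    · filter_upwards [Metric.ball_mem_nhds x (by linarith : 0 < ε / 2)] with y hy using hqm y hy
    · exact (ae_mem_surf Ω).mono fun ξ hξ y hy => hbound ξ hξ y hy
    · exact (ae_mem_surf Ω).mono fun ξ hξ y hy =>
        (hasFDerivAt_q1 hm hα hξ.2 (by linarith [hy0 y hy]) (hyne y hy ξ hξ)).const_mul (ρ ξ)

/-- Every point of the chord is within `‖ξ - t‖` of `t`, so the normals met there differ from `n t`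
by at most `a ‖ξ - t‖^κ`. The gain of `κ` over the trivial bound makes the kernel on `Γ` weakly
singular. -/
theorem abs_inner_sub_le_rpow (hΩ : IsLyapunovDomain Ω n) {a κ : ℝ} (ha : 0 < a) (hκ : 0 < κ)
    (hn : ∀ x ∈ surf Ω, ∀ y ∈ surf Ω, ‖n x - n y‖ ≤ a * dist x y ^ κ)
    {t ξ : EuclideanSpace ℝ (Fin m)} (ht : t ∈ surf Ω) (hξ : ξ ∈ surf Ω) :
    |⟪t - ξ, n t⟫| ≤ a * ‖ξ - t‖ ^ κ * ‖ξ - t‖ := by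
  rw [real_inner_comm, norm_sub_rev ξ t]
  refine hΩ.abs_inner_le_of_normal_close hξ ht fun z hz => ?_
  refine (hn z hz.1 t ht).trans ?_
  have h1 : dist z t ≤ dist ξ t := by
    rw [dist_comm z t, dist_comm ξ t]
    have h2 := dist_add_dist_of_mem_segment hz.2
    have h3 := dist_nonneg (x := ξ) (y := z)
    rw [dist_comm t z, dist_comm t ξ]
    linarith
  rw [dist_eq_norm ξ, norm_sub_rev ξ t] at h1
  gcongr

/-- Distances from points on the normal at `t` to points of `Γ`. -/
theorem exists_normal_dist_bound (hΩ : IsLyapunovDomain Ω n)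
    {t : EuclideanSpace ℝ (Fin m)} (ht : t ∈ surf Ω) :
    ∃ δ > 0, ∀ s : ℝ, |s| < δ → ∀ ξ ∈ surf Ω,
      ‖ξ - t‖ ≤ 2 * ‖t + s • n t - ξ‖ ∧ |s| ≤ 3 * ‖t + s • n t - ξ‖ := by
  obtain ⟨δ, hδ, hflat⟩ := hΩ.exists_radius_norm_sub_le (L := 2) (by norm_num)
  have hnt := hΩ.norm_normal ht
  refine ⟨δ / 2, half_pos hδ, fun s hs ξ hξ => ?_⟩
  have hsn : ‖s • n t‖ = |s| := by rw [norm_smul, hnt, mul_one, Real.norm_eq_abs]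
  have h1 : ‖ξ - t‖ ≤ 2 * ‖t + s • n t - ξ‖ := by
    -- Near `t`, moving along the normal does not change the projection of `t - ξ`, so flatness with
    -- `L = 2` applies. Far from `t`, the displacement `|s| < δ / 2` is less than half of `‖ξ - t‖`.
    rcases lt_or_ge ‖ξ - t‖ δ with h | h
    · have h2 := hflat t ht t ⟨ht, Metric.mem_ball_self hδ⟩ ξ
        ⟨hξ, by rwa [Metric.mem_ball, dist_eq_norm]⟩
      have h3 : (ℝ ∙ n t)ᗮ.orthogonalProjectionOnto (n t) = 0 :=
        Submodule.orthogonalProjectionOnto_apply_of_mem_orthogonal (by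
          rw [Submodule.orthogonal_orthogonal]
          exact Submodule.mem_span_singleton_self _)
      have h4 : (ℝ ∙ n t)ᗮ.orthogonalProjectionOnto (t - ξ) =
          (ℝ ∙ n t)ᗮ.orthogonalProjectionOnto (t + s • n t - ξ) := by
        rw [show t + s • n t - ξ = (t - ξ) + s • n t by abel, map_add, map_smul, h3, smul_zero,
          add_zero]
      rw [h4, norm_sub_rev] at h2
      refine h2.trans ?_
      have := Submodule.norm_orthogonalProjectionOnto_apply_le (ℝ ∙ n t)ᗮ (t + s • n t - ξ)
      simpa using this
    · have h2 : ‖ξ - t‖ ≤ ‖t + s • n t - ξ‖ + ‖s • n t‖ := by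
        rw [norm_sub_rev, show t - ξ = (t + s • n t - ξ) - s • n t by abel]
        exact norm_sub_le _ _
      linarith
  refine ⟨h1, ?_⟩
  have h2 : |s| ≤ ‖t + s • n t - ξ‖ + ‖ξ - t‖ := by
    rw [← hsn]
    calc ‖s • n t‖ = ‖(t + s • n t - ξ) + (ξ - t)‖ := by congr 1; abel
      _ ≤ _ := norm_add_le _ _
  linarith

end IsLyapunovDomain

/-- The normalisation of `k₁`. -/
theorem two_mul_qConst_mul {m : ℕ} (hm : 2 < m) {α : ℝ} (hα : 0 < α) (hα₁ : 2 * α < 1)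
    {s : ℝ} (hs : 0 < s) :
    2 * (α + ((m : ℝ) - 2) / 2) * qConst m α * (Real.pi ^ ((m : ℝ) / 2) / Real.Gamma ((m : ℝ) / 2) *
      ((4 * s * s) ^ (-α) * eulerJ α α (α + (m : ℝ) / 2 - α - α) 1)) =
      1 / 2 * s ^ (-(2 * α)) := by
  have hm' : (3 : ℝ) ≤ m := by exact_mod_cast hm
  have ha : 0 < α + ((m : ℝ) - 2) / 2 := by linarith
  -- This cancels the factor `α + (m-2)/2` from differentiation against the denominator of `eulerJ`
  -- at 1. The numerator there contains `Γ(m/2)`, which cancels against the Poisson mass.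
  have hG : Real.Gamma (α + (m : ℝ) / 2) =
      (α + ((m : ℝ) - 2) / 2) * Real.Gamma (α + ((m : ℝ) - 2) / 2) := by
    rw [← Real.Gamma_add_one ha.ne']
    congr 1
    ring
  have h4 : (4 : ℝ) ^ (1 - α) = 4 * 4 ^ (-α) := by
    rw [sub_eq_add_neg, Real.rpow_add (by norm_num), Real.rpow_one]
  have hs2 : (4 * s * s) ^ (-α) = 4 ^ (-α) * s ^ (-(2 * α)) := by
    rw [mul_assoc, Real.mul_rpow (by norm_num) (by positivity), ← sq, ← Real.rpow_two,
      ← Real.rpow_mul hs.le]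
    congr 2
    ring
  rw [eulerJ_one hα hα (by linarith),
    show α + (α + (m : ℝ) / 2 - α - α) = (m : ℝ) / 2 by ring, hG, hs2, qConst, k1, h4,
    show 2 * α - α = α by ring]
  have g1 := (Real.Gamma_pos_of_pos hα).ne'
  have g2 := (Real.Gamma_pos_of_pos (by linarith : 0 < 2 * α)).ne'
  have g3 := (Real.Gamma_pos_of_pos ha).ne'
  have g4 := (Real.Gamma_pos_of_pos (by linarith : 0 < (m : ℝ) / 2)).ne'
  have g5 : Real.pi ^ ((m : ℝ) / 2) ≠ 0 := (Real.rpow_pos_of_pos Real.pi_pos _).ne'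
  have g6 : (4 : ℝ) ^ (-α) ≠ 0 := by positivity
  generalize Real.Gamma (α + ((m : ℝ) - 2) / 2) = x at *
  generalize α + ((m : ℝ) - 2) / 2 = a at *
  have g7 := ha.ne'
  field_simp
  norm_num

theorem aestronglyMeasurable_of_continuousOn_diff (hm : 2 < m) {f : EuclideanSpace ℝ (Fin m) → ℝ}
    {x : EuclideanSpace ℝ (Fin m)} (hf : ContinuousOn f (surf Ω \ {x})) :
    AEStronglyMeasurable f (surfMeasure Ω) := by
  have h : (surfMeasure Ω).restrict (surf Ω \ {x}) = surfMeasure Ω :=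
    Measure.restrict_eq_self_of_ae_mem (by
      filter_upwards [ae_mem_surf Ω, ae_ne_surfMeasure hm Ω x] with ξ h1 h2 using ⟨h1, h2⟩)
  rw [← h]
  exact hf.aestronglyMeasurable (measurableSet_surf.diff (measurableSet_singleton x))

/-! ### The jump relation -/

namespace IsLyapunovDomain

/-- The part of the normal derivative that is continuous across `Γ`. -/
theorem tendsto_integral_regular_part (hΩ : IsLyapunovDomain Ω n)
    (hm : 2 < m) {α : ℝ} (hα₀ : 0 < 2 * α) (hα₁ : 2 * α < 1)
    {ρ : EuclideanSpace ℝ (Fin m) → ℝ} (hρ : ContinuousOn ρ (closure (surf Ω)))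
    {t : EuclideanSpace ℝ (Fin m)} (ht : t ∈ surf Ω) {G : ℝ → EuclideanSpace ℝ (Fin m) → ℝ}
    (hG : ∀ s ξ, G s ξ = ρ ξ * (kerW α α (α + (m : ℝ) / 2) ξ (t + s • n t) * ⟪t - ξ, n t⟫ +
      2 * ξ 0 * kerW (α + 1) α (α + (m : ℝ) / 2) ξ (t + s • n t) * n t 0)) :
    (∀ᶠ s in 𝓝 0, Integrable (G s) (surfMeasure Ω)) ∧
    Tendsto (fun s => ∫ ξ, G s ξ ∂(surfMeasure Ω)) (𝓝 0) (𝓝 (∫ ξ, G 0 ξ ∂(surfMeasure Ω))) := by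
  have hm' : (3 : ℝ) ≤ m := by exact_mod_cast hm
  have hα : 0 < α := by linarith
  have ht0 : 0 < t 0 := ht.2
  obtain ⟨N, hN0, hN⟩ := hΩ.exists_density_bound hρ
  obtain ⟨X, hX0, hX⟩ := hΩ.exists_first_coord_bound
  obtain ⟨a, κ, ha, hκ, hκ1, hn⟩ := hΩ.exists_holder_normal
  obtain ⟨δ, hδ, hdist⟩ := hΩ.exists_normal_dist_bound ht
  obtain ⟨M₁, hM₁, hb₁⟩ := exists_kerW_bound (m := m) (u := α) (v := α)
    (p := α + (m : ℝ) / 2) hα hα (by linarith) (half_pos ht0)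
  obtain ⟨M₂, hM₂, hb₂⟩ := exists_kerW_bound (m := m) (u := α + 1) (v := α)
    (p := α + (m : ℝ) / 2) (by linarith) hα (by linarith) (half_pos ht0)
  have hxc : Continuous fun s : ℝ => t + s • n t := by fun_prop
  have hcoord : ∀ᶠ s : ℝ in 𝓝 0, t 0 / 2 < (t + s • n t) 0 := by
    refine (by fun_prop : Continuous fun s : ℝ => (t + s • n t) 0).continuousAt.eventually
      (lt_mem_nhds ?_)
    simpa using ht0
  have hsmall : ∀ᶠ s : ℝ in 𝓝 0, |s| < δ := by
    have := Metric.ball_mem_nhds (0 : ℝ) hδ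
    filter_upwards [this] with s hs
    simpa using hs
  have hnt0 : |n t 0| ≤ 1 := by
    rw [← hΩ.norm_normal ht]
    exact PiLp.norm_apply_le (n t) 0
  -- The first exponent combines `r^(-m)` with `‖ξ - t‖^(1+κ)`, the second is that of the first-axis
  -- term. Both exceed `-(m-1)`, so `bd` is integrable. The powers of `1/4` come from `‖ξ - t‖ ≤ 2
  -- ‖x - ξ‖`, which makes the bound independent of `s`.
  set bd : EuclideanSpace ℝ (Fin m) → ℝ := fun ξ =>
    N * (M₁ * a * (1 / 4 : ℝ) ^ (-(m : ℝ) / 2) * ‖ξ - t‖ ^ (-((m : ℝ) - 1 - κ)) +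
      2 * X * M₂ * (1 / 4 : ℝ) ^ (1 - (m : ℝ) / 2) * ‖ξ - t‖ ^ (-((m : ℝ) - 2))) with hbd
  have hbdi : Integrable bd (surfMeasure Ω) :=
    (((hΩ.integrable_norm_sub_rpow hm ht (by linarith) (by linarith)).const_mul _).add
      ((hΩ.integrable_norm_sub_rpow hm ht (by linarith) (by linarith)).const_mul _)).const_mul _
  have hpow : ∀ s : ℝ, |s| < δ → ∀ ξ ∈ surf Ω, ξ ≠ t → ∀ e ≤ (0 : ℝ),
      (‖t + s • n t - ξ‖ ^ 2) ^ e ≤ (1 / 4 : ℝ) ^ e * ‖ξ - t‖ ^ (2 * e) := by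
    intro s hs ξ hξ hne e he
    have hd : 0 < ‖ξ - t‖ := norm_pos_iff.2 (sub_ne_zero.2 hne)
    have h1 := (hdist s hs ξ hξ).1
    rw [Real.rpow_mul hd.le, ← Real.mul_rpow (by positivity) (by positivity)]
    refine Real.rpow_le_rpow_of_nonpos (by positivity) ?_ he
    rw [Real.rpow_two]
    nlinarith
  have hle : ∀ s : ℝ, |s| < δ → t 0 / 2 < (t + s • n t) 0 → ∀ ξ ∈ surf Ω, ξ ≠ t →
      ‖G s ξ‖ ≤ bd ξ := by
    intro s hs hs0 ξ hξ hne
    have hd : 0 < ‖ξ - t‖ := norm_pos_iff.2 (sub_ne_zero.2 hne)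
    have hnx : ξ ≠ t + s • n t := by
      intro h
      have := (hdist s hs ξ hξ).1
      rw [← h, sub_self, norm_zero, mul_zero] at this
      linarith
    have h1 := (hb₁ ξ _ (le_of_lt hξ.2) hs0.le hnx).trans
      (mul_le_mul_of_nonneg_left (hpow s hs ξ hξ hne _ (by linarith)) hM₁)
    have h2 := (hb₂ ξ _ (le_of_lt hξ.2) hs0.le hnx).trans
      (mul_le_mul_of_nonneg_left (hpow s hs ξ hξ hne _ (by linarith)) hM₂)
    have h3 := hN ξ hξ
    have h4 := hX ξ hξ
    have h5 := hΩ.abs_inner_sub_le_rpow ha hκ hn ht hξ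
    have e1 : ‖ξ - t‖ ^ (2 * (α - (α + (m : ℝ) / 2))) * (‖ξ - t‖ ^ κ * ‖ξ - t‖) =
        ‖ξ - t‖ ^ (-((m : ℝ) - 1 - κ)) := by
      rw [← Real.rpow_add_one hd.ne', ← Real.rpow_add hd]
      congr 1
      ring
    rw [hG, norm_mul, Real.norm_eq_abs, Real.norm_eq_abs]
    refine mul_le_mul h3 ((abs_add_le _ _).trans (add_le_add ?_ ?_)) (abs_nonneg _) hN0
    · rw [abs_mul]
      calc _ ≤ M₁ * ((1 / 4 : ℝ) ^ (α - (α + (m : ℝ) / 2)) *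
            ‖ξ - t‖ ^ (2 * (α - (α + (m : ℝ) / 2)))) * (a * ‖ξ - t‖ ^ κ * ‖ξ - t‖) := by gcongr
        _ = _ := by
          rw [← e1, show α - (α + (m : ℝ) / 2) = -(m : ℝ) / 2 by ring]
          ring
    · rw [abs_mul, abs_mul, abs_mul, abs_two]
      calc _ ≤ 2 * X * (M₂ * ((1 / 4 : ℝ) ^ (α + 1 - (α + (m : ℝ) / 2)) *
            ‖ξ - t‖ ^ (2 * (α + 1 - (α + (m : ℝ) / 2))))) * 1 := by gcongr
        _ = _ := by
          rw [show α + 1 - (α + (m : ℝ) / 2) = 1 - (m : ℝ) / 2 by ring,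
            show 2 * (1 - (m : ℝ) / 2) = -((m : ℝ) - 2) by ring]
          ring
  have hmeas : ∀ s : ℝ, t 0 / 2 < (t + s • n t) 0 →
      AEStronglyMeasurable (G s) (surfMeasure Ω) := by
    intro s hs0
    have hx0 : 0 < (t + s • n t) 0 := by linarith
    refine aestronglyMeasurable_of_continuousOn_diff hm (x := t + s • n t) ?_
    have hsub : surf Ω \ {t + s • n t} ⊆ {ξ | 0 ≤ ξ 0 ∧ ξ ≠ t + s • n t} := fun ξ hξ =>
      ⟨le_of_lt hξ.1.2, hξ.2⟩
    have hA := (continuousOn_kerW_left (u := α) (v := α) (p := α + (m : ℝ) / 2) hα hα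
      (by linarith) hx0).mono hsub
    have hB := (continuousOn_kerW_left (u := α + 1) (v := α) (p := α + (m : ℝ) / 2)
      (by linarith) hα (by linarith) hx0).mono hsub
    have hρc : ContinuousOn ρ (surf Ω \ {t + s • n t}) :=
      hρ.mono (Set.sdiff_subset.trans subset_closure)
    have hi : Continuous fun ξ : EuclideanSpace ℝ (Fin m) => ⟪t - ξ, n t⟫ := by fun_prop
    have h0 : Continuous fun ξ : EuclideanSpace ℝ (Fin m) => 2 * ξ 0 := by fun_prop
    exact (hρc.mul ((hA.mul hi.continuousOn).add ((h0.continuousOn.mul hB).mul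
      continuousOn_const))).congr fun ξ _ => hG s ξ
  have hae : ∀ᵐ ξ ∂(surfMeasure Ω), ξ ∈ surf Ω ∧ ξ ≠ t :=
    (ae_mem_surf Ω).and (ae_ne_surfMeasure hm Ω t)
  constructor
  · filter_upwards [hcoord, hsmall] with s hs0 hs
    exact hbdi.mono' (hmeas s hs0) (hae.mono fun ξ hξ => hle s hs hs0 ξ hξ.1 hξ.2)
  · refine tendsto_integral_filter_of_dominated_convergence bd ?_ ?_ hbdi ?_
    · filter_upwards [hcoord] with s hs0 using hmeas s hs0
    · filter_upwards [hcoord, hsmall] with s hs0 hs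
      exact hae.mono fun ξ hξ => hle s hs hs0 ξ hξ.1 hξ.2
    · refine hae.mono fun ξ hξ => ?_
      have hx0 : 0 < (t + (0 : ℝ) • n t) 0 := by simpa using ht0
      have hne : ξ ≠ t + (0 : ℝ) • n t := by simpa using hξ.2
      have hA := (continuousAt_kerW_right (u := α) (v := α) (p := α + (m : ℝ) / 2) hα hα
        (by linarith) (le_of_lt hξ.1.2) hx0 hne).comp (f := fun s : ℝ => t + s • n t)
        hxc.continuousAt
      have hB := (continuousAt_kerW_right (u := α + 1) (v := α) (p := α + (m : ℝ) / 2)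
        (by linarith) hα (by linarith) (le_of_lt hξ.1.2) hx0 hne).comp
        (f := fun s : ℝ => t + s • n t) hxc.continuousAt
      simp only [hG]
      exact (((hA.tendsto.mul_const _).add ((hB.tendsto.const_mul _).mul_const _)).const_mul _)

/-- The part of the normal derivative that jumps across `Γ`. -/
theorem tendsto_integral_singular_part (hΩ : IsLyapunovDomain Ω n)
    (hm : 2 < m) {α : ℝ} (hα₀ : 0 < 2 * α)
    (hα₁ : 2 * α < 1) {ρ : EuclideanSpace ℝ (Fin m) → ℝ} (hρ : ContinuousOn ρ (closure (surf Ω)))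
    {t : EuclideanSpace ℝ (Fin m)} (ht : t ∈ surf Ω) {η : ℝ} (hη : |η| = 1) :
    Tendsto (fun h => ∫ ξ, ρ ξ * (h * kerW α α (α + (m : ℝ) / 2) ξ (t + (η * h) • n t))
        ∂(surfMeasure Ω)) (𝓝[>] 0)
      (𝓝 (Real.pi ^ ((m : ℝ) / 2) / Real.Gamma ((m : ℝ) / 2) *
        (ρ t * ((4 * t 0 * t 0) ^ (-α) * eulerJ α α (α + (m : ℝ) / 2 - α - α) 1)))) := by
  have hm' : (3 : ℝ) ≤ m := by exact_mod_cast hm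
  have hα : 0 < α := by linarith
  have ht0 : 0 < t 0 := ht.2
  have hnt := hΩ.norm_normal ht
  have hη2 : η ^ 2 = 1 := by rw [← sq_abs, hη, one_pow]
  obtain ⟨N, hN0, hN⟩ := hΩ.exists_density_bound hρ
  obtain ⟨a, κ, ha, hκ, hκ1, hn⟩ := hΩ.exists_holder_normal
  obtain ⟨δ, hδ, hdist⟩ := hΩ.exists_normal_dist_bound ht
  obtain ⟨M₁, hM₁, hb₁⟩ := exists_kerW_bound (m := m) (u := α) (v := α)
    (p := α + (m : ℝ) / 2) hα hα (by linarith) (half_pos ht0)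
  set P : ℝ → EuclideanSpace ℝ (Fin m) → ℝ :=
    fun h ξ => h * (h ^ 2 + ‖ξ - t‖ ^ 2) ^ (-(m : ℝ) / 2) with hP
  set x : ℝ → EuclideanSpace ℝ (Fin m) := fun h => t + (η * h) • n t with hx
  -- `K` is the integrand divided by the Poisson kernel `P`. It has to be bounded and to have a
  -- limit at `t`.
  set K : ℝ → EuclideanSpace ℝ (Fin m) → ℝ := fun h ξ =>
    ρ ξ * (kerW α α (α + (m : ℝ) / 2) ξ (x h) * (h ^ 2 + ‖ξ - t‖ ^ 2) ^ ((m : ℝ) / 2)) with hK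
  have hxc : Continuous x := by fun_prop
  have hx0 : x 0 = t := by simp [hx]
  have hpos : ∀ᶠ h : ℝ in 𝓝[>] 0, 0 < h := self_mem_nhdsWithin
  have hcoord : ∀ᶠ h : ℝ in 𝓝[>] 0, t 0 / 2 < x h 0 := by
    have : Continuous fun h : ℝ => x h 0 := by fun_prop
    refine (this.continuousAt.eventually (lt_mem_nhds ?_)).filter_mono nhdsWithin_le_nhds
    simp only [hx0]
    linarith
  have hsmall : ∀ᶠ h : ℝ in 𝓝[>] 0, |η * h| < δ := by
    filter_upwards [Ioo_mem_nhdsGT hδ] with h hh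
    rw [abs_mul, hη, one_mul, abs_of_pos hh.1]
    exact hh.2
  have hne : ∀ h, 0 < h → |η * h| < δ → ∀ ξ ∈ surf Ω, ξ ≠ x h := by
    intro h hh hs ξ hξ heq
    have := (hdist (η * h) hs ξ hξ).2
    rw [show t + (η * h) • n t = ξ from heq.symm, sub_self, norm_zero, mul_zero, abs_mul, hη,
      one_mul, abs_of_pos hh] at this
    linarith
  have hKeq : ∀ h, 0 < h → |η * h| < δ → t 0 / 2 < x h 0 → ∀ ξ ∈ surf Ω, K h ξ =
      ρ ξ * (((h ^ 2 + ‖ξ - t‖ ^ 2) / ‖x h - ξ‖ ^ 2) ^ ((m : ℝ) / 2) *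
        ((‖x h - ξ‖ ^ 2 + 4 * ξ 0 * x h 0) ^ (-α) * eulerJ α α (α + (m : ℝ) / 2 - α - α)
          (4 * ξ 0 * x h 0 / (‖x h - ξ‖ ^ 2 + 4 * ξ 0 * x h 0)))) := by
    intro h hh hs hs0 ξ hξ
    have hn0 : 0 < ‖x h - ξ‖ := norm_pos_iff.2 (sub_ne_zero.2 (hne h hh hs ξ hξ).symm)
    simp only [hK]
    rw [kerW_eq α α _ (le_of_lt hξ.2) (by linarith) (hne h hh hs ξ hξ),
      Real.div_rpow (by positivity) (by positivity),
      show α - (α + (m : ℝ) / 2) = -((m : ℝ) / 2) by ring, Real.rpow_neg (by positivity)]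
    ring
  -- The limit is taken jointly in `h` and `ξ`, which provides the uniformity in `h` required of an
  -- approximate identity.
  have hlim : Tendsto (fun z : ℝ × EuclideanSpace ℝ (Fin m) => K z.1 z.2)
      (𝓝[>] 0 ×ˢ 𝓝[surf Ω] t)
      (𝓝 (ρ t * ((4 * t 0 * t 0) ^ (-α) * eulerJ α α (α + (m : ℝ) / 2 - α - α) 1))) := by
    have hfst : Tendsto (Prod.fst : ℝ × EuclideanSpace ℝ (Fin m) → ℝ)
        (𝓝[>] 0 ×ˢ 𝓝[surf Ω] t) (𝓝[>] 0) := tendsto_fst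
    have hsnd : Tendsto (Prod.snd : ℝ × EuclideanSpace ℝ (Fin m) → EuclideanSpace ℝ (Fin m))
        (𝓝[>] 0 ×ˢ 𝓝[surf Ω] t) (𝓝[surf Ω] t) := tendsto_snd
    have hfst' := hfst.mono_right nhdsWithin_le_nhds
    have hsnd' := hsnd.mono_right nhdsWithin_le_nhds
    have hxlim : Tendsto (fun z : ℝ × EuclideanSpace ℝ (Fin m) => x z.1)
        (𝓝[>] 0 ×ˢ 𝓝[surf Ω] t) (𝓝 t) := by
      have := (hxc.tendsto 0).comp hfst'
      rwa [hx0] at this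
    have hco : Continuous fun y : EuclideanSpace ℝ (Fin m) => y 0 := by fun_prop
    have hblim : Tendsto (fun z : ℝ × EuclideanSpace ℝ (Fin m) => 4 * z.2 0 * x z.1 0)
        (𝓝[>] 0 ×ˢ 𝓝[surf Ω] t) (𝓝 (4 * t 0 * t 0)) :=
      (((hco.tendsto t).comp hsnd').const_mul 4).mul ((hco.tendsto t).comp hxlim)
    have hRlim : Tendsto (fun z : ℝ × EuclideanSpace ℝ (Fin m) =>
        ‖x z.1 - z.2‖ ^ 2 + 4 * z.2 0 * x z.1 0) (𝓝[>] 0 ×ˢ 𝓝[surf Ω] t)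
        (𝓝 (4 * t 0 * t 0)) := by
      have := ((hxlim.sub hsnd').norm.pow 2).add hblim
      simpa using this
    have hdlim : Tendsto (fun z : ℝ × EuclideanSpace ℝ (Fin m) => a * ‖z.2 - t‖ ^ κ)
        (𝓝[>] 0 ×ˢ 𝓝[surf Ω] t) (𝓝 0) := by
      have h1 : Tendsto (fun z : ℝ × EuclideanSpace ℝ (Fin m) => ‖z.2 - t‖)
          (𝓝[>] 0 ×ˢ 𝓝[surf Ω] t) (𝓝 0) := by
        simpa using (hsnd'.sub_const t).norm
      have h2 := ((Real.continuous_rpow_const hκ.le).tendsto 0).comp h1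
      rw [Real.zero_rpow hκ.ne'] at h2
      simpa using h2.const_mul a
    have hev : ∀ᶠ z : ℝ × EuclideanSpace ℝ (Fin m) in 𝓝[>] 0 ×ˢ 𝓝[surf Ω] t,
        (0 < z.1 ∧ |η * z.1| < δ ∧ t 0 / 2 < x z.1 0) ∧ z.2 ∈ surf Ω :=
      (hfst.eventually (hpos.and (hsmall.and hcoord))).and (hsnd.eventually self_mem_nhdsWithin)
    -- Expanding `‖x h - ξ‖²` gives `h² + ‖ξ - t‖²` plus a cross term. By the Hölder estimate and
    -- `2ab ≤ a² + b²`, the cross term is at most `a ‖ξ - t‖^κ` times this sum, whatever the ratio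
    -- of `h` to `‖ξ - t‖`.
    have hratio : Tendsto (fun z : ℝ × EuclideanSpace ℝ (Fin m) =>
        (z.1 ^ 2 + ‖z.2 - t‖ ^ 2) / ‖x z.1 - z.2‖ ^ 2) (𝓝[>] 0 ×ˢ 𝓝[surf Ω] t) (𝓝 1) := by
      have hinv : Tendsto (fun z : ℝ × EuclideanSpace ℝ (Fin m) =>
          ‖x z.1 - z.2‖ ^ 2 / (z.1 ^ 2 + ‖z.2 - t‖ ^ 2)) (𝓝[>] 0 ×ˢ 𝓝[surf Ω] t) (𝓝 1) := by
        rw [tendsto_iff_norm_sub_tendsto_zero]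
        refine squeeze_zero' (Eventually.of_forall fun z => norm_nonneg _) ?_ hdlim
        filter_upwards [hev] with z hz
        obtain ⟨⟨hh, -, -⟩, hξ⟩ := hz
        have hden : 0 < z.1 ^ 2 + ‖z.2 - t‖ ^ 2 := by positivity
        have h1 : ‖x z.1 - z.2‖ ^ 2 = ‖z.2 - t‖ ^ 2 + 2 * (η * z.1 * ⟪t - z.2, n t⟫) + z.1 ^ 2 := by
          rw [show x z.1 - z.2 = (t - z.2) + (η * z.1) • n t by simp only [hx]; abel,
            norm_add_sq_real, real_inner_smul_right, norm_smul, hnt, mul_one, norm_sub_rev t,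
            Real.norm_eq_abs, sq_abs, mul_pow, hη2, one_mul]
        have h2 := hΩ.abs_inner_sub_le_rpow ha hκ hn ht hξ
        rw [h1, Real.norm_eq_abs, div_sub_one hden.ne', abs_div, abs_of_pos hden,
          div_le_iff₀ hden, show ‖z.2 - t‖ ^ 2 + 2 * (η * z.1 * ⟪t - z.2, n t⟫) + z.1 ^ 2 -
            (z.1 ^ 2 + ‖z.2 - t‖ ^ 2) = 2 * (η * z.1 * ⟪t - z.2, n t⟫) by ring, abs_mul, abs_mul,
          abs_mul, hη, abs_of_pos hh, abs_two, one_mul]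
        have h3 : 0 ≤ a * ‖z.2 - t‖ ^ κ := by positivity
        have h4 : 2 * z.1 * ‖z.2 - t‖ ≤ z.1 ^ 2 + ‖z.2 - t‖ ^ 2 := two_mul_le_add_sq _ _
        calc 2 * (z.1 * |⟪t - z.2, n t⟫|) ≤ 2 * (z.1 * (a * ‖z.2 - t‖ ^ κ * ‖z.2 - t‖)) := by gcongr
          _ = a * ‖z.2 - t‖ ^ κ * (2 * z.1 * ‖z.2 - t‖) := by ring
          _ ≤ _ := by gcongr
      have h5 := hinv.inv₀ one_ne_zero
      rw [inv_one] at h5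
      refine h5.congr fun z => ?_
      rw [inv_div]
    have hb0 : 4 * t 0 * t 0 ≠ 0 := by positivity
    have hwlim : Tendsto (fun z : ℝ × EuclideanSpace ℝ (Fin m) =>
        4 * z.2 0 * x z.1 0 / (‖x z.1 - z.2‖ ^ 2 + 4 * z.2 0 * x z.1 0))
        (𝓝[>] 0 ×ˢ 𝓝[surf Ω] t) (𝓝[Set.Icc 0 1] 1) := by
      refine tendsto_nhdsWithin_iff.2 ⟨?_, ?_⟩
      · have := hblim.div hRlim hb0
        rwa [div_self hb0] at this
      · filter_upwards [hev] with z hz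
        exact argument_mem_Icc (le_of_lt hz.2.2) (by linarith [hz.1.2.2])
    have hJ : Tendsto (fun z : ℝ × EuclideanSpace ℝ (Fin m) =>
        eulerJ α α (α + (m : ℝ) / 2 - α - α)
          (4 * z.2 0 * x z.1 0 / (‖x z.1 - z.2‖ ^ 2 + 4 * z.2 0 * x z.1 0)))
        (𝓝[>] 0 ×ˢ 𝓝[surf Ω] t) (𝓝 (eulerJ α α (α + (m : ℝ) / 2 - α - α) 1)) :=
      Tendsto.comp (continuousOn_eulerJ hα hα (by linarith) 1 (by simp)) hwlim
    have hρlim : Tendsto (fun z : ℝ × EuclideanSpace ℝ (Fin m) => ρ z.2)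
        (𝓝[>] 0 ×ˢ 𝓝[surf Ω] t) (𝓝 (ρ t)) :=
      Tendsto.comp ((hρ.mono subset_closure) t ht) hsnd
    have hall := hρlim.mul ((hratio.rpow_const (p := (m : ℝ) / 2) (Or.inl one_ne_zero)).mul
      ((hRlim.rpow_const (p := -α) (Or.inl hb0)).mul hJ))
    rw [Real.one_rpow, one_mul] at hall
    refine hall.congr' ?_
    filter_upwards [hev] with z hz
    exact (hKeq z.1 hz.1.1 hz.1.2.1 hz.1.2.2 z.2 hz.2).symm
  have hmain := tendsto_integral_mul_of_approx_identity (μ := surfMeasure Ω) (t := t)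
    (l := 𝓝[>] 0) (P := P) (K := K)
    (c := Real.pi ^ ((m : ℝ) / 2) / Real.Gamma ((m : ℝ) / 2))
    (k := ρ t * ((4 * t 0 * t 0) ^ (-α) * eulerJ α α (α + (m : ℝ) / 2 - α - α) 1))
    (M := N * (M₁ * 13 ^ ((m : ℝ) / 2))) ?_ ?_ (hΩ.tendsto_integral_poisson_surf hm ht)
    ?_ ?_ ?_ ?_
  · refine hmain.congr' ?_
    filter_upwards [hpos] with h hh
    refine integral_congr_ae (Eventually.of_forall fun ξ => ?_)
    have h1 : (h ^ 2 + ‖ξ - t‖ ^ 2) ^ (-(m : ℝ) / 2) *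
        (h ^ 2 + ‖ξ - t‖ ^ 2) ^ ((m : ℝ) / 2) = 1 := by
      rw [← Real.rpow_add (by positivity), neg_div, neg_add_cancel, Real.rpow_zero]
    simp only [hP, hK]
    linear_combination (h * ρ ξ * kerW α α (α + (m : ℝ) / 2) ξ (x h)) * h1
  · filter_upwards [hpos] with h hh ξ
    positivity
  · filter_upwards [hpos] with h hh
    exact hΩ.integrable_poisson_surf (by positivity) t hh
  · intro r hr
    refine squeeze_zero' ?_ (g := fun h => h * ((r ^ 2) ^ (-(m : ℝ) / 2) *
      (surfMeasure Ω).real Set.univ)) ?_ ?_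
    · filter_upwards [hpos] with h hh
      exact integral_nonneg fun ξ => by positivity
    · filter_upwards [hpos] with h hh
      exact hΩ.setIntegral_compl_ball_poisson_surf_le (by positivity) t hh hr
    · have h3 := (by fun_prop : Continuous fun h : ℝ => h * ((r ^ 2) ^ (-(m : ℝ) / 2) *
        (surfMeasure Ω).real Set.univ)).tendsto 0
      rw [zero_mul] at h3
      exact h3.mono_left nhdsWithin_le_nhds
  · filter_upwards [hcoord] with h hc
    refine aestronglyMeasurable_of_continuousOn_diff hm (x := x h) ?_
    have hA := (continuousOn_kerW_left (u := α) (v := α) (p := α + (m : ℝ) / 2) hα hα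
      (by linarith) (by linarith : 0 < x h 0)).mono
      (fun ξ (hξ : ξ ∈ surf Ω \ {x h}) => ⟨le_of_lt hξ.1.2, hξ.2⟩)
    have hc2 : Continuous fun ξ : EuclideanSpace ℝ (Fin m) =>
        (h ^ 2 + ‖ξ - t‖ ^ 2) ^ ((m : ℝ) / 2) :=
      (by fun_prop : Continuous fun ξ : EuclideanSpace ℝ (Fin m) =>
        h ^ 2 + ‖ξ - t‖ ^ 2).rpow_const fun ξ => Or.inr (by positivity)
    exact (hρ.mono (Set.sdiff_subset.trans subset_closure)).mul (hA.mul hc2.continuousOn)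
  · filter_upwards [hpos, hsmall, hcoord] with h hh hs hc
    refine (ae_mem_surf Ω).mono fun ξ hξ => ?_
    have hn0 : 0 < ‖x h - ξ‖ := norm_pos_iff.2 (sub_ne_zero.2 (hne h hh hs ξ hξ).symm)
    have h1 := hb₁ ξ (x h) (le_of_lt hξ.2) hc.le (hne h hh hs ξ hξ)
    obtain ⟨h2, h3⟩ := hdist (η * h) hs ξ hξ
    change ‖ξ - t‖ ≤ 2 * ‖x h - ξ‖ at h2
    change _ ≤ 3 * ‖x h - ξ‖ at h3
    rw [abs_mul, hη, one_mul, abs_of_pos hh] at h3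
    -- `13 = 3² + 2²`, from the two bounds `h3` and `h2`.
    have h4 : h ^ 2 + ‖ξ - t‖ ^ 2 ≤ 13 * ‖x h - ξ‖ ^ 2 := by
      nlinarith [norm_nonneg (ξ - t)]
    simp only [hK]
    rw [abs_mul, abs_mul, abs_of_nonneg (by positivity : 0 ≤ (h ^ 2 + ‖ξ - t‖ ^ 2) ^ ((m : ℝ) / 2))]
    refine mul_le_mul (hN ξ hξ) ?_ (by positivity) hN0
    calc _ ≤ M₁ * (‖x h - ξ‖ ^ 2) ^ (α - (α + (m : ℝ) / 2)) *
          (13 * ‖x h - ξ‖ ^ 2) ^ ((m : ℝ) / 2) := by gcongr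
      _ = M₁ * 13 ^ ((m : ℝ) / 2) := by
        rw [Real.mul_rpow (by norm_num) (by positivity),
          show α - (α + (m : ℝ) / 2) = -((m : ℝ) / 2) by ring, Real.rpow_neg (by positivity)]
        have : (‖x h - ξ‖ ^ 2) ^ ((m : ℝ) / 2) ≠ 0 := by positivity
        field_simp
  · intro ε hε
    have hev := hlim.eventually (Metric.closedBall_mem_nhds _ hε)
    obtain ⟨pa, hpa, pb, hpb, hab⟩ := eventually_prod_iff.1 hev
    obtain ⟨r, hr, hrb⟩ := Metric.mem_nhdsWithin_iff.1 hpb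
    refine ⟨r, hr, hpa.mono fun h hh => (ae_mem_surf Ω).mono fun ξ hξ hd => ?_⟩
    have := hab hh (hrb ⟨hd, hξ⟩)
    rwa [Real.dist_eq] at this

/-- The limit of the normal derivative of the potential from the side `η = ±1`. -/
theorem tendsto_fderiv_simpleLayer (hΩ : IsLyapunovDomain Ω n)
    (hm : 2 < m) {α : ℝ} (hα₀ : 0 < 2 * α) (hα₁ : 2 * α < 1)
    {ρ : EuclideanSpace ℝ (Fin m) → ℝ} (hρ : ContinuousOn ρ (closure (surf Ω)))
    {t : EuclideanSpace ℝ (Fin m)} (ht : t ∈ surf Ω) {η : ℝ} (hη : |η| = 1) :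
    Integrable (fun ξ => ρ ξ * qDeriv α ξ t (n t)) (surfMeasure Ω) ∧
    Tendsto (fun h => fderiv ℝ (simpleLayer α Ω ρ) (t + (η * h) • n t) (n t)) (𝓝[>] 0)
      (𝓝 (-(η * (1 / 2 * t 0 ^ (-(2 * α)) * ρ t)) +
        ∫ ξ, ρ ξ * qDeriv α ξ t (n t) ∂(surfMeasure Ω))) := by
  have hα : 0 < α := by linarith
  have hnt := hΩ.norm_normal ht
  set c₀ : ℝ := 2 * (α + ((m : ℝ) - 2) / 2) * qConst m α with hc₀
  set G : ℝ → EuclideanSpace ℝ (Fin m) → ℝ := fun s ξ =>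
    ρ ξ * (kerW α α (α + (m : ℝ) / 2) ξ (t + s • n t) * ⟪t - ξ, n t⟫ +
      2 * ξ 0 * kerW (α + 1) α (α + (m : ℝ) / 2) ξ (t + s • n t) * n t 0) with hG
  obtain ⟨hGi, hGlim⟩ := hΩ.tendsto_integral_regular_part hm hα₀ hα₁ hρ ht (G := G)
    fun s ξ => rfl
  have hsing := hΩ.tendsto_integral_singular_part hm hα₀ hα₁ hρ ht hη
  have hq0 : ∀ ξ, ρ ξ * qDeriv α ξ t (n t) = -c₀ * G 0 ξ := by
    intro ξ
    simp only [hG, zero_smul, add_zero]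
    rw [qDeriv_apply]
    ring
  refine ⟨?_, ?_⟩
  · simp_rw [hq0]
    exact hGi.self_of_nhds.const_mul _
  have hηlim : Tendsto (fun h : ℝ => η * h) (𝓝[>] 0) (𝓝 0) := by
    have := (by fun_prop : Continuous fun h : ℝ => η * h).tendsto 0
    rw [mul_zero] at this
    exact this.mono_left nhdsWithin_le_nhds
  have htot := ((hGlim.comp hηlim).const_mul (-c₀)).add (hsing.const_mul (-c₀ * η))
  have hval : -c₀ * ∫ ξ, G 0 ξ ∂(surfMeasure Ω) +
      -c₀ * η * (Real.pi ^ ((m : ℝ) / 2) / Real.Gamma ((m : ℝ) / 2) *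
        (ρ t * ((4 * t 0 * t 0) ^ (-α) * eulerJ α α (α + (m : ℝ) / 2 - α - α) 1))) =
      -(η * (1 / 2 * t 0 ^ (-(2 * α)) * ρ t)) +
        ∫ ξ, ρ ξ * qDeriv α ξ t (n t) ∂(surfMeasure Ω) := by
    simp_rw [hq0]
    rw [integral_const_mul, ← two_mul_qConst_mul hm hα hα₁ ht.2]
    ring
  rw [hval] at htot
  refine htot.congr' ?_
  obtain ⟨δ, hδ, hdist⟩ := hΩ.exists_normal_dist_bound ht
  have hxc : Continuous fun h : ℝ => t + (η * h) • n t := by fun_prop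
  have hhalf : ∀ᶠ h : ℝ in 𝓝[>] 0, t + (η * h) • n t ∈ halfSpace m := by
    refine (hxc.continuousAt.eventually (isOpen_halfSpace.mem_nhds ?_)).filter_mono
      nhdsWithin_le_nhds
    simpa using ht.2
  filter_upwards [Ioo_mem_nhdsGT hδ, hhalf, hηlim.eventually hGi] with h hh hxh hGh
  have habs : |η * h| = h := by rw [abs_mul, hη, one_mul, abs_of_pos hh.1]
  have hnot : t + (η * h) • n t ∉ surf Ω := by
    intro hmem
    have := (hdist (η * h) (by rw [habs]; exact hh.2) _ hmem).2
    rw [sub_self, norm_zero, mul_zero, habs] at this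
    linarith [hh.1]
  obtain ⟨-, hi, hd⟩ := hΩ.hasFDerivAt_simpleLayer hm hα₀ hα₁ hρ ⟨hxh, hnot⟩
  -- `⟪x - ξ, n t⟫ = ⟪t - ξ, n t⟫ + η h`: the first summand goes into the regular part `G`, the
  -- second produces the Poisson-type integral carrying the sign `η`.
  have hsplit : ∀ ξ, (ρ ξ • qDeriv α ξ (t + (η * h) • n t)) (n t) = -c₀ * G (η * h) ξ +
      -c₀ * η * (ρ ξ * (h * kerW α α (α + (m : ℝ) / 2) ξ (t + (η * h) • n t))) := by
    intro ξ
    have h1 : ⟪t + (η * h) • n t - ξ, n t⟫ = ⟪t - ξ, n t⟫ + η * h := by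
      rw [show t + (η * h) • n t - ξ = (t - ξ) + (η * h) • n t by abel, inner_add_left,
        real_inner_smul_left, real_inner_self_eq_norm_sq, hnt]
      ring
    rw [smul_apply, qDeriv_apply, h1, smul_eq_mul]
    simp only [hG]
    ring
  have hiapp := hi.apply_continuousLinearMap (n t)
  have hsi : Integrable (fun ξ => -c₀ * η *
      (ρ ξ * (h * kerW α α (α + (m : ℝ) / 2) ξ (t + (η * h) • n t)))) (surfMeasure Ω) := by
    refine (hiapp.sub (hGh.const_mul (-c₀))).congr (Eventually.of_forall fun ξ => ?_)
    simp only [Pi.sub_apply]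
    rw [hsplit]
    ring
  rw [hd.fderiv, ContinuousLinearMap.integral_apply hi]
  simp_rw [hsplit]
  rw [integral_add (hGh.const_mul _) hsi, integral_const_mul, integral_const_mul]
  rfl

end IsLyapunovDomain

end SimpleLayer

theorem theorem3 (m : ℕ) [NeZero m] (hm : 2 < m) (α : ℝ) (hα₀ : 0 < 2 * α) (hα₁ : 2 * α < 1)
    (Ω : Set (EuclideanSpace ℝ (Fin m)))
    (n : EuclideanSpace ℝ (Fin m) → EuclideanSpace ℝ (Fin m))
    (hΩ : IsLyapunovDomain Ω n)
    (ρ : EuclideanSpace ℝ (Fin m) → ℝ) (hρ : ContinuousOn ρ (closure (surf Ω))) :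
    -- off `Γ` the potential is an absolutely convergent integral and is differentiable
    (∀ x ∈ halfSpace m \ surf Ω, Integrable (fun ξ => ρ ξ * q1 α ξ x) (surfMeasure Ω) ∧
      DifferentiableAt ℝ (simpleLayer α Ω ρ) x) ∧
    ∀ t ∈ surf Ω,
      -- the normal at `t` enters `Ω` on the inner side and leaves its closure on the outer side
      (∀ᶠ h : ℝ in 𝓝[>] 0, t - h • n t ∈ Ω ∧ t + h • n t ∈ halfSpace m \ closure Ω) ∧
      Integrable (fun s => ρ s * K1 α n s t) (surfMeasure Ω) ∧
      ∃ Li Le : ℝ,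
        -- limits of the normal derivative along the normal at `t`, from inside and from outside
        Tendsto (fun h : ℝ => fderiv ℝ (simpleLayer α Ω ρ) (t - h • n t) (n t))
          (𝓝[>] 0) (𝓝 Li) ∧
        Tendsto (fun h : ℝ => fderiv ℝ (simpleLayer α Ω ρ) (t + h • n t) (n t))
          (𝓝[>] 0) (𝓝 Le) ∧
        t 0 ^ (2 * α) * Li = 1 / 2 * ρ t + ∫ s, ρ s * K1 α n s t ∂(surfMeasure Ω) ∧
        t 0 ^ (2 * α) * Le = -(1 / 2) * ρ t + ∫ s, ρ s * K1 α n s t ∂(surfMeasure Ω) ∧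
        Li - Le = t 0 ^ (-(2 * α)) * ρ t := by
  have hα : 0 < α := by linarith
  refine ⟨fun x hx => ?_, fun t ht => ?_⟩
  · obtain ⟨h1, -, h2⟩ := hΩ.hasFDerivAt_simpleLayer hm hα₀ hα₁ hρ hx
    exact ⟨h1, h2.differentiableAt⟩
  have ht0 : 0 < t 0 := ht.2
  obtain ⟨hInt, hin⟩ := hΩ.tendsto_fderiv_simpleLayer hm hα₀ hα₁ hρ ht (η := -1) (by simp)
  obtain ⟨-, hex⟩ := hΩ.tendsto_fderiv_simpleLayer hm hα₀ hα₁ hρ ht (η := 1) (by simp)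
  -- `K1` is defined through `fderiv`, which is identified with `qDeriv` only for `s ≠ t`; the
  -- exceptional point is null.
  have hK : (fun s => ρ s * K1 α n s t) =ᵐ[surfMeasure Ω]
      fun s => t 0 ^ (2 * α) * (ρ s * qDeriv α s t (n t)) := by
    filter_upwards [ae_mem_surf Ω, ae_ne_surfMeasure hm Ω t] with s hs hne
    rw [K1, (hasFDerivAt_q1 hm hα hs.2 ht0 hne).fderiv]
    ring
  have hKint : ∫ s, ρ s * K1 α n s t ∂(surfMeasure Ω) =
      t 0 ^ (2 * α) * ∫ s, ρ s * qDeriv α s t (n t) ∂(surfMeasure Ω) := by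
    rw [integral_congr_ae hK, integral_const_mul]
  have hpow : t 0 ^ (2 * α) * t 0 ^ (-(2 * α)) = 1 := by
    rw [← Real.rpow_add ht0, add_neg_cancel, Real.rpow_zero]
  refine ⟨?_, (hInt.const_mul _).congr hK.symm, _, _,
    hin.congr fun h => by rw [neg_one_mul, neg_smul, ← sub_eq_add_neg],
    hex.congr fun h => by rw [one_mul], ?_, ?_, ?_⟩
  · have hsides := hΩ.eventually_sides (v := n t) ht (by
      rw [real_inner_self_eq_norm_sq, hΩ.norm_normal ht]
      simp)
    have hhalf : ∀ᶠ h : ℝ in 𝓝[>] 0, t + h • n t ∈ halfSpace m := by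
      refine ((by fun_prop : Continuous fun h : ℝ => t + h • n t).continuousAt.eventually
        (isOpen_halfSpace.mem_nhds ?_)).filter_mono nhdsWithin_le_nhds
      simpa using ht.2
    filter_upwards [hsides.1, hsides.2, hhalf] with h h1 h2 h3 using ⟨h1, h3, h2⟩
  · rw [hKint]
    linear_combination (1 / 2 * ρ t) * hpow
  · rw [hKint]
    linear_combination (-(1 / 2) * ρ t) * hpow
  · ring
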